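/- Let $X$ be a compact metric space with a Borel probability measure $\mu$, let $\mathcal H$ be a separable complex Hilbert space with C*-algebra $\mathfrak K$ of compact operators, and let $\mathfrak A=C(X,\mathfrak K)$, with unitization $\mathfrak A^+$. Let $H=H^*\in\mathfrak A$ and let $\lambda\in\mathrm{Spec}(H)\setminus\{0\}$, the spectrum being taken in $\mathfrak A^+$. Let $\mathbb F=\{x\in X:\lambda\in\mathrm{Spec}(H(x))\}$ be the Fermi surface. The energy functions of $H$ are the functions $\varepsilon_n^{\pm}:X\to\mathbb R$, $n\ge 0$, where $\varepsilon^+_n(x)$ is the $n$-th largest positive eigenvalue of $H(x)$ and $\varepsilon_n^-(x)$ the $n$-th smallest negative one, eigenvalues being repeated according to multiplicity (counting starts at $n=0$), and where the value is $0$ if $H(x)$ has at most $n$ eigenvalues of that sign. Assume: 1. (finite band contribution) only finitely many energy functions $\varepsilon_{1},\dots,\varepsilon_{M}$ (after relabelling) attain the value $\lambda$ on $X$; 2. (local gap) $\inf_{x\in\mathbb F}\mathrm{dist}\big(\lambda,\mathrm{Spec}(H(x))\setminus\{\lambda\}\big)>0$ (with $\mathrm{dist}(\lambda,\emptyset)=+\infty$).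 Put $f(x)=\prod_{j=1}^M(\varepsilon_{j}(x)-\lambda)$. A disintegration of $\mu$ with respect to a Borel map $h:X\to\mathbb R$, with pushforward $\nu=\mu\circ h^{-1}$, is a family $(\mu_t)_{t\in\mathbb R}$ of Borel probability measures on $X$ such that, for every $\psi\in L^1(\mu)$, the function $t\mapsto\int_X\psi\,d\mu_t$ is $\nu$-integrable and $\int_X\psi\,(\phi\circ h)\,d\mu=\int_{\mathbb R}\big(\int_X\psi\,d\mu_t\big)\phi(t)\,d\nu(t)$ for all bounded Borel functions $\phi:\mathbb R\to\mathbb C$. A Fermi measure is the member $\mu_\lambda$ of a disintegration $(\mu_t)_{t\in\mathbb R}$ of $\mu$ with respect to $f+\lambda$ such that $\mu_t$ is carried by $f^{-1}(\{t-\lambda\})$ for every $t$ for which this set is nonempty. For $x\in\mathbb F$ let $P(x)$ be the spectral projection of $H(x)$ for the eigenvalue $\lambda$, and put $\rho(x)=P(x)/\mathrm{Tr}\,P(x)$; put $\rho(x)=0$ for $x\notin\mathbb F$. Then a Fermi measure exists, and for every Fermi measure $\mu_\lambda$ the functions $x\mapsto\mathrm{Tr}(\rho(x)A(x))$, $A\in\mathfrak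 A$, are $\mu_\lambda$-integrable, and $$\omega(A)=\int_X\mathrm{Tr}\big(\rho(x)A(x)\big)\,d\mu_\lambda(x),\qquad A\in\mathfrak A,$$ defines a bounded linear functional whose canonical extension $A+c\mathbf 1\mapsto\omega(A)+c\|\omega\|$ to $\mathfrak A^+$ is an eigenstate of $H$ with eigenvalue $\lambda$; that is, it is a positive linear functional with value $1$ at $\mathbf 1$, and it satisfies $\omega(BH)=\lambda\,\omega(B)$ for all $B\in\mathfrak A^+$. -/

import Mathlib

open scoped ComplexOrder InnerProductSpace
open MeasureTheory

noncomputable section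

namespace FermiEigenstate

/-! ### The algebra of compact operators -/

section Compact

variable {𝓗 : Type*} [NormedAddCommGroup 𝓗] [InnerProductSpace ℂ 𝓗] [CompleteSpace 𝓗]

/-- Schauder's theorem on a Hilbert space: the adjoint of a compact operator is compact. -/
theorem isCompactOperator_star {T : 𝓗 →L[ℂ] 𝓗} (hT : IsCompactOperator T) :
    IsCompactOperator (star T : 𝓗 →L[ℂ] 𝓗) := by
  rw [ContinuousLinearMap.star_eq_adjoint]
  set S := ContinuousLinearMap.adjoint T with hS
  have hTS : IsCompactOperator (T ∘L S) := hT.comp_clm S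
  refine (isCompactOperator_iff_isCompact_closure_image_closedBall
    (S : 𝓗 →ₗ[ℂ] 𝓗) one_pos).2 ?_
  have h1 : TotallyBounded ((T ∘L S) '' Metric.closedBall (0 : 𝓗) 1) :=
    ((isCompactOperator_iff_isCompact_closure_image_closedBall
      ((T ∘L S : 𝓗 →L[ℂ] 𝓗) : 𝓗 →ₗ[ℂ] 𝓗) one_pos).1 hTS).totallyBounded.subset subset_closure
  refine TotallyBounded.isCompact_of_isClosed (TotallyBounded.closure ?_) isClosed_closure
  rw [Metric.totallyBounded_iff]
  intro ε hε
  obtain ⟨t, hts, htf, hcov⟩ :=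
    Metric.finite_approx_of_totallyBounded h1 (ε ^ 2 / 4) (by positivity)
  obtain ⟨u, hu, huf, rfl⟩ := Set.exists_subset_image_finite_and.1 ⟨t, hts, htf, rfl⟩
  refine ⟨S '' u, huf.image _, ?_⟩
  rintro _ ⟨y, hy, rfl⟩
  have := hcov ⟨y, hy, rfl⟩
  simp only [Set.mem_iUnion, exists_prop, Set.exists_mem_image, Metric.mem_ball] at this ⊢
  obtain ⟨z, hz, hyz⟩ := this
  refine ⟨z, hz, ?_⟩
  rw [dist_eq_norm] at hyz ⊢
  have hz' := hu hz
  rw [mem_closedBall_zero_iff] at hy hz'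
  have e1 : ‖y - z‖ ≤ 2 := (norm_sub_le _ _).trans (by linarith)
  have e2 : ‖S (y - z)‖ ^ 2 ≤ ‖T (S (y - z))‖ * ‖y - z‖ := by
    have : ‖S (y - z)‖ ^ 2 = (inner ℂ (S (y - z)) (S (y - z))).re := by
      rw [inner_self_eq_norm_sq_to_K]; norm_cast
    rw [this]
    conv_lhs => rw [hS, ContinuousLinearMap.adjoint_inner_right]
    exact (Complex.re_le_norm _).trans (norm_inner_le_norm _ _)
  have e3 : ‖T (S (y - z))‖ < ε ^ 2 / 4 := by simpa [map_sub] using hyz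
  have e4 : ‖S (y - z)‖ ^ 2 < ε ^ 2 := by nlinarith [norm_nonneg (T (S (y - z)))]
  have := lt_of_pow_lt_pow_left₀ 2 hε.le e4
  simpa [map_sub] using this

variable (𝓗) in
/-- The compact operators on a Hilbert space, as a ⋆-subalgebra of the bounded operators. -/
def compactOps : NonUnitalStarSubalgebra ℂ (𝓗 →L[ℂ] 𝓗) where
  carrier := {T | IsCompactOperator T}
  add_mem' ha hb := IsCompactOperator.add ha hb
  zero_mem' := isCompactOperator_zero
  smul_mem' c _ ha := IsCompactOperator.smul ha c
  mul_mem' {a b} ha _ := IsCompactOperator.comp_clm (f := a) ha b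
  star_mem' ha := isCompactOperator_star ha

/-- The compact operators are norm closed. -/
theorem isClosed_compactOps : IsClosed (compactOps 𝓗 : Set (𝓗 →L[ℂ] 𝓗)) :=
  isClosed_setOfPred_isCompactOperator

end Compact

/-- The (in general non-unital) C⋆-algebra `𝔎` of compact operators on a Hilbert space. -/
def CompactOp (𝓗 : Type*) [NormedAddCommGroup 𝓗] [InnerProductSpace ℂ 𝓗] [CompleteSpace 𝓗] :
    Type _ :=
  compactOps 𝓗

namespace CompactOp

variable {𝓗 : Type*} [NormedAddCommGroup 𝓗] [InnerProductSpace ℂ 𝓗] [CompleteSpace 𝓗]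

/-- The C⋆-algebra structure inherited from the bounded operators. -/
instance : NonUnitalCStarAlgebra (CompactOp 𝓗) :=
  haveI : IsClosed (compactOps 𝓗 : Set (𝓗 →L[ℂ] 𝓗)) := isClosed_compactOps
  inferInstanceAs (NonUnitalCStarAlgebra (compactOps 𝓗))

/-- A compact operator as a bounded operator. -/
def toCLM (T : CompactOp 𝓗) : 𝓗 →L[ℂ] 𝓗 :=
  Subtype.val (p := fun S => S ∈ compactOps 𝓗) T

instance : Coe (CompactOp 𝓗) (𝓗 →L[ℂ] 𝓗) := ⟨toCLM⟩

end CompactOp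


/-! ### States and eigenstates -/

section States

/-- A state of a unital C⋆-algebra: a positive linear functional with value `1` at the unit. -/
structure IsState {B : Type*} [Ring B] [StarRing B] [Algebra ℂ B] (φ : B →ₗ[ℂ] ℂ) : Prop where
  nonneg : ∀ b : B, 0 ≤ φ (star b * b)
  map_one : φ 1 = 1

/-- `φ` is an eigenstate of `a` with eigenvalue `z`. -/
structure IsEigenstate {B : Type*} [Ring B] [StarRing B] [Algebra ℂ B] (φ : B →ₗ[ℂ] ℂ)
    (a : B) (z : ℂ) : Prop where
  isState : IsState φ
  map_mul : ∀ b : B, φ (b * a) = z * φ b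

/-- The canonical extension `a + c𝟏 ↦ ω(a) + c‖ω‖` of a bounded (positive) functional `ω` on a
C⋆-algebra to its unitization. -/
def canonicalExtension {A : Type*} [NonUnitalCStarAlgebra A] (ω : A →L[ℂ] ℂ) :
    Unitization ℂ A →ₗ[ℂ] ℂ where
  toFun z := ω z.snd + z.fst * (‖ω‖ : ℂ)
  map_add' z w := by simp only [Unitization.snd_add, Unitization.fst_add, map_add]; ring
  map_smul' c z := by
    simp only [Unitization.snd_smul, Unitization.fst_smul, map_smul, smul_eq_mul,
      RingHom.id_apply]
    ring

end States

/-! ### Disintegration of measures -/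

section Disintegration

variable {X Y : Type*} [MeasurableSpace X] [MeasurableSpace Y]

/-- `e` represents the expectation `E_ψ ∈ L¹(Y, ν)` of `ψ`, where `ν` is the pushforward of `μ`
by `f`: it is `ν`-integrable and `∫ ψ · (φ ∘ f) dμ = ∫ e · φ dν` for all bounded Borel `φ`. -/
structure IsExpectation (μ : Measure X) (f : X → Y) (ψ : X → ℂ) (e : Y → ℂ) : Prop where
  integrable : Integrable e (μ.map f)
  integral_eq : ∀ φ : Y → ℂ, Measurable φ → (∃ C : ℝ, ∀ y, ‖φ y‖ ≤ C) →
    ∫ x, ψ x * φ (f x) ∂μ = ∫ y, e y * φ y ∂(μ.map f)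

/-- `y ↦ κ y` is a disintegration of `μ` with respect to `f`: every `κ y` is a probability
measure, and for each `ψ ∈ L¹(μ)` the function `y ↦ ∫ ψ dκ_y` is a representative of `E_ψ`. -/
structure IsDisintegration (μ : Measure X) (f : X → Y) (κ : Y → Measure X) : Prop where
  isProbabilityMeasure : ∀ y, IsProbabilityMeasure (κ y)
  isExpectation : ∀ ψ : X → ℂ, Integrable ψ μ → IsExpectation μ f ψ fun y => ∫ x, ψ x ∂(κ y)

end Disintegration

/-! ### Spectral data of a single operator -/

section Operators

variable {𝓗 : Type*} [NormedAddCommGroup 𝓗] [InnerProductSpace ℂ 𝓗]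

/-- The eigenspace `ker (T - z)`. -/
def eigSpace (T : 𝓗 →L[ℂ] 𝓗) (z : ℂ) : Submodule ℂ 𝓗 :=
  (T - z • ContinuousLinearMap.id ℂ 𝓗).ker

/-- The `n`-th (`n = 0, 1, …`) largest positive eigenvalue of a compact self-adjoint operator `T`,
the eigenvalues being repeated according to their multiplicity, and `0` if `T` has at most `n`
positive eigenvalues: the largest `t > 0` such that the eigenspaces of `T` for the eigenvalues
`≥ t` span a space of dimension at least `n + 1` (recall `sSup ∅ = 0`). -/
def upperEigenvalue (T : 𝓗 →L[ℂ] 𝓗) (n : ℕ) : ℝ :=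
  sSup {t : ℝ | 0 < t ∧ ((n + 1 : ℕ) : Cardinal) ≤
    Module.rank ℂ ↥(⨆ s : {s : ℝ // t ≤ s}, eigSpace T ((s : ℝ) : ℂ))}

/-- The enumeration, with multiplicity, of the nonzero eigenvalues of a compact self-adjoint
operator, padded by zeros: `Sum.inl n` is the `n`-th largest positive eigenvalue, and `Sum.inr n`
is the `n`-th smallest negative eigenvalue. -/
def eigenvalueSeq (T : 𝓗 →L[ℂ] 𝓗) : ℕ ⊕ ℕ → ℝ
  | Sum.inl n => upperEigenvalue T n
  | Sum.inr n => -upperEigenvalue (-T) n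

variable [CompleteSpace 𝓗]

/-- The trace `∑ ⟪bᵢ, T bᵢ⟫`, computed in some orthonormal basis `b`; see `hasSum_opTrace` for its
independence of `b` in the case that matters here. -/
def opTrace (T : 𝓗 →L[ℂ] 𝓗) : ℂ :=
  ∑' i, inner ℂ ((exists_hilbertBasis ℂ 𝓗).choose_spec.choose i)
    (T ((exists_hilbertBasis ℂ 𝓗).choose_spec.choose i))

theorem hasSum_diagonal (T : 𝓗 →L[ℂ] 𝓗) [FiniteDimensional ℂ T.range] {ι : Type*}
    (b : HilbertBasis ι ℂ 𝓗) : HasSum (fun i => inner ℂ (b i) (T (b i)))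
      (∑ j, inner ℂ (ContinuousLinearMap.adjoint T (stdOrthonormalBasis ℂ T.range j : 𝓗))
        (stdOrthonormalBasis ℂ T.range j : 𝓗)) := by
  have h (v : 𝓗) : T v = ∑ j, inner ℂ (stdOrthonormalBasis ℂ T.range j : 𝓗) (T v) •
      (stdOrthonormalBasis ℂ T.range j : 𝓗) := by
    have := (stdOrthonormalBasis ℂ T.range).sum_repr' ⟨T v, v, rfl⟩
    simpa using (congrArg (Subtype.val) this).symm
  have e : (fun i => inner ℂ (b i) (T (b i))) = fun i => ∑ j,
      inner ℂ (ContinuousLinearMap.adjoint T (stdOrthonormalBasis ℂ T.range j : 𝓗)) (b i) *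
        inner ℂ (b i) (stdOrthonormalBasis ℂ T.range j : 𝓗) := by
    funext i
    conv_lhs => rw [h (b i)]
    simp only [inner_sum, inner_smul_right, ContinuousLinearMap.adjoint_inner_left]
  rw [e]
  exact hasSum_sum fun j _ => b.hasSum_inner_mul_inner _ _

/-- For a finite rank operator, `∑ ⟪bᵢ, T bᵢ⟫` converges to the trace in every orthonormal
basis. -/
theorem hasSum_opTrace (T : 𝓗 →L[ℂ] 𝓗) [FiniteDimensional ℂ T.range] {ι : Type*}
    (b : HilbertBasis ι ℂ 𝓗) : HasSum (fun i => inner ℂ (b i) (T (b i))) (opTrace T) := by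
  have h := hasSum_diagonal T b
  rwa [← (hasSum_diagonal T (exists_hilbertBasis ℂ 𝓗).choose_spec.choose).tsum_eq] at h

/-- The spectral projection of a self-adjoint operator `T` for the eigenvalue `z`, that is, the
orthogonal projection onto `ker (T - z)`. -/
def spectralProj (T : 𝓗 →L[ℂ] 𝓗) (z : ℂ) : 𝓗 →L[ℂ] 𝓗 :=
  haveI : CompleteSpace (eigSpace T z) :=
    inferInstanceAs (CompleteSpace (T - z • ContinuousLinearMap.id ℂ 𝓗).ker)
  (eigSpace T z).starProjection

end Operators

/-! ### Fermi surfaces and Fermi measures -/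

section Fermi

variable {X : Type*} [TopologicalSpace X]
  {𝓗 : Type*} [NormedAddCommGroup 𝓗] [InnerProductSpace ℂ 𝓗] [CompleteSpace 𝓗]

/-- The Fermi surface `{x | l ∈ Spec(H(x))}`. -/
def fermiSurface (H : C(X, CompactOp 𝓗)) (l : ℝ) : Set X :=
  {x | (l : ℂ) ∈ spectrum ℂ (H x : 𝓗 →L[ℂ] 𝓗)}

/-- The energy functions (bands) of `H`. -/
def energy (H : C(X, CompactOp 𝓗)) (n : ℕ ⊕ ℕ) (x : X) : ℝ :=
  eigenvalueSeq (H x : 𝓗 →L[ℂ] 𝓗) n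

/-- The labels of the energy functions which attain the value `l`. -/
def bandsMeeting (H : C(X, CompactOp 𝓗)) (l : ℝ) : Set (ℕ ⊕ ℕ) :=
  {n | (energy H n ⁻¹' {l}).Nonempty}

/-- Finite band contribution: only finitely many energy functions attain the value `l`. -/
def FiniteBandContribution (H : C(X, CompactOp 𝓗)) (l : ℝ) : Prop :=
  (bandsMeeting H l).Finite

/-- Local gap condition: the infimum over the Fermi surface of the distances
`dist (l, Spec(H(x)) \ {l})` is positive. -/
def LocalGap (H : C(X, CompactOp 𝓗)) (l : ℝ) : Prop :=
  0 < ⨅ x ∈ fermiSurface H l,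
    Metric.infEDist (l : ℂ) (spectrum ℂ (H x : 𝓗 →L[ℂ] 𝓗) \ {(l : ℂ)})

/-- The function `x ↦ ∏ⱼ (εₙⱼ(x) - l)`, the product being over the bands which attain `l`. -/
def bandProduct (H : C(X, CompactOp 𝓗)) (l : ℝ) (hfin : FiniteBandContribution H l) (x : X) :
    ℝ :=
  ∏ n ∈ Set.Finite.toFinset hfin, (energy H n x - l)

/-- `m` is a Fermi measure: the member with label `t = l` of a disintegration `(κ t)` of `μ` along
`f + l`, with `f` the band product, such that `κ t` is carried by the level set `f = t - l`
for every `t` for which this set is nonempty. -/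
def IsFermiMeasure [MeasurableSpace X] (μ : Measure X) (H : C(X, CompactOp 𝓗)) (l : ℝ)
    (hfin : FiniteBandContribution H l) (m : Measure X) : Prop :=
  ∃ κ : ℝ → Measure X,
    IsDisintegration μ (fun x => bandProduct H l hfin x + l) κ ∧
    (∀ t, {x | bandProduct H l hfin x = t - l}.Nonempty →
      κ t {x | bandProduct H l hfin x = t - l}ᶜ = 0) ∧
    m = κ l

open Classical in
/-- The density matrix: the normalized spectral projection `P(x) / Tr P(x)` of `H(x)` for the
eigenvalue `l` on the Fermi surface, and `0` elsewhere. -/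
def densityMatrix (H : C(X, CompactOp 𝓗)) (l : ℝ) (x : X) : 𝓗 →L[ℂ] 𝓗 :=
  if x ∈ fermiSurface H l then
    (opTrace (spectralProj (H x : 𝓗 →L[ℂ] 𝓗) l))⁻¹ • spectralProj (H x : 𝓗 →L[ℂ] 𝓗) l
  else 0

end Fermi

end FermiEigenstate

end

/-!
The disintegration of `μ` along `f + l`, with `f` the band product, is the regular conditional
distribution on the standard Borel space `X`. Two facts make a Fermi measure a probability measure
on the Fermi surface. First, the energy functions are Borel: by the max-min principle
(`le_rank_eigSpan`) the number of eigenvalues above a threshold can only grow under small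
perturbations, so the eigenvalues are lower semicontinuous in the operator. Second, the Fermi
surface is the zero set of `f` (`bandProduct_eq_zero_iff`), and it is nonempty because otherwise
`(l - H(x))⁻¹` would yield an inverse of `l - H` in the unitization (`fermiSurface_nonempty`).

For `x` on the Fermi surface `A ↦ Tr(ρ(x) A)` is the normalized trace of the compression of `A` to
the finite-dimensional eigenspace of `H(x)`, hence an eigenstate of `H(x)` on the bounded operators
(`compressedTrace_isEigenstate`). It depends measurably on `x`, as the mean ergodic theorem exhibits
the spectral projection of `H(x)` as a strong limit of polynomials in `H(x)`
(`tendsto_birkhoffAverage_spectralProj`).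

Integrating these local eigenstates against a probability measure on the Fermi surface gives an
eigenstate of `H` on the unitization, by pointwise verification. It is the canonical extension of
its restriction `ω` to `C(X, 𝔎)` exactly when `‖ω‖ = 1`. This is `norm_fermiFunctional`: with
`G = 1 - (H - l)² / C` and `C` large, `Gⁿ` has norm at most `1` and value `1` in the state, while
its scalar part `(1 - l² / C)ⁿ` tends to `0` because `l ≠ 0`.
-/

noncomputable section

namespace FermiEigenstate

open Filter Topology

/-! ### Spectral theory of compact self-adjoint operators -/

section Spectral

variable {𝓗 : Type*} [NormedAddCommGroup 𝓗] [InnerProductSpace ℂ 𝓗]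

theorem mem_eigSpace {T : 𝓗 →L[ℂ] 𝓗} {z : ℂ} {v : 𝓗} : v ∈ eigSpace T z ↔ T v = z • v := by
  simp [eigSpace, sub_eq_zero]

theorem eigSpace_eq_eigenspace (T : 𝓗 →L[ℂ] 𝓗) (z : ℂ) :
    eigSpace T z = Module.End.eigenspace (T : Module.End ℂ 𝓗) z := by
  ext v
  rw [mem_eigSpace, Module.End.mem_eigenspace_iff]
  rfl

theorem eigSpace_neg (T : 𝓗 →L[ℂ] 𝓗) (z : ℂ) : eigSpace (-T) (-z) = eigSpace T z := by
  ext v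
  simp [mem_eigSpace]

/-- The span of the eigenspaces of `T` for the real eigenvalues in `p`. -/
def eigSpan (T : 𝓗 →L[ℂ] 𝓗) (p : ℝ → Prop) : Submodule ℂ 𝓗 :=
  ⨆ s : {s : ℝ // p s}, eigSpace T ((s : ℝ) : ℂ)

theorem eigSpace_le_eigSpan (T : 𝓗 →L[ℂ] 𝓗) {p : ℝ → Prop} {s : ℝ} (hs : p s) :
    eigSpace T s ≤ eigSpan T p :=
  le_iSup (fun s : {s : ℝ // p s} => eigSpace T ((s : ℝ) : ℂ)) ⟨s, hs⟩

theorem eigSpan_mono (T : 𝓗 →L[ℂ] 𝓗) {p q : ℝ → Prop}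
    (h : ∀ s, p s → eigSpace T (s : ℂ) ≠ ⊥ → q s) : eigSpan T p ≤ eigSpan T q := by
  refine iSup_le fun s => ?_
  by_cases hs : eigSpace T ((s : ℝ) : ℂ) = ⊥
  · simp [hs]
  · exact eigSpace_le_eigSpan T (h s s.2 hs)

theorem eigSpan_neg (T : 𝓗 →L[ℂ] 𝓗) (p : ℝ → Prop) :
    eigSpan (-T) (fun s => p (-s)) = eigSpan T p := by
  refine le_antisymm (iSup_le fun s => ?_) (iSup_le fun s => ?_)
  · have := eigSpace_neg T (-((s : ℝ) : ℂ))
    rw [neg_neg] at this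
    rw [this, ← Complex.ofReal_neg]
    exact eigSpace_le_eigSpan T s.2
  · rw [← eigSpace_neg, ← Complex.ofReal_neg]
    exact eigSpace_le_eigSpan (p := fun s => p (-s)) (-T) (by simpa using s.2)

/-- Distinct eigenspaces are orthogonal, so the quadratic form of `T` on a sum of eigenvectors is
the sum of its values. -/
theorem le_re_inner_of_mem_eigSpan {T : 𝓗 →L[ℂ] 𝓗} (hT : (T : 𝓗 →ₗ[ℂ] 𝓗).IsSymmetric)
    {p : ℝ → Prop} {a : ℝ} (hp : ∀ s, p s → a ≤ s) {v : 𝓗} (hv : v ∈ eigSpan T p) :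
    a * ‖v‖ ^ 2 ≤ (inner ℂ v (T v)).re := by
  have hV : OrthogonalFamily ℂ (fun s : {s : ℝ // p s} => eigSpace T ((s : ℝ) : ℂ))
      fun s => (eigSpace T ((s : ℝ) : ℂ)).subtypeₗᵢ := by
    intro s r hsr x y
    exact hT.orthogonalFamily_eigenspaces
      (fun h => hsr (Subtype.ext (Complex.ofReal_injective h)))
      ⟨x, eigSpace_eq_eigenspace T _ ▸ x.2⟩ ⟨y, eigSpace_eq_eigenspace T _ ▸ y.2⟩
  obtain ⟨f, hf, rfl⟩ := (Submodule.mem_iSup_iff_exists_finsupp _ _).1 hv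
  set w : ∀ s : {s : ℝ // p s}, eigSpace T ((s : ℝ) : ℂ) := fun s => ⟨f s, hf s⟩
  have e1 : (f.sum fun _ x => x) =
      ∑ s ∈ f.support, (eigSpace T ((s : ℝ) : ℂ)).subtypeₗᵢ (w s) := rfl
  have e2 : T (f.sum fun _ x => x) = ∑ s ∈ f.support,
      (eigSpace T ((s : ℝ) : ℂ)).subtypeₗᵢ (((s : ℝ) : ℂ) • w s) := by
    rw [e1, map_sum]
    refine Finset.sum_congr rfl fun s _ => ?_
    exact mem_eigSpace.1 (hf s)
  rw [e2, e1, hV.inner_sum, hV.norm_sum, Finset.mul_sum, Complex.re_sum]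
  refine Finset.sum_le_sum fun s _ => ?_
  rw [inner_smul_right, inner_self_eq_norm_sq_to_K]
  have : ((((s : ℝ) : ℂ)) * ((‖w s‖ : ℂ)) ^ 2).re = s * ‖w s‖ ^ 2 := by
    rw [← Complex.ofReal_pow, ← Complex.ofReal_mul, Complex.ofReal_re]
  exact (mul_le_mul_of_nonneg_right (hp s s.2) (by positivity)).trans_eq this.symm

theorem re_inner_le_of_mem_eigSpan {T : 𝓗 →L[ℂ] 𝓗} (hT : (T : 𝓗 →ₗ[ℂ] 𝓗).IsSymmetric)
    {p : ℝ → Prop} {a : ℝ} (hp : ∀ s, p s → s ≤ a) {v : 𝓗} (hv : v ∈ eigSpan T p) :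
    (inner ℂ v (T v)).re ≤ a * ‖v‖ ^ 2 := by
  rw [← eigSpan_neg] at hv
  have h : ((-T : 𝓗 →L[ℂ] 𝓗) : 𝓗 →ₗ[ℂ] 𝓗).IsSymmetric := fun x y => by
    have := hT x y
    simpa using this
  have := le_re_inner_of_mem_eigSpan h (a := -a) (fun s hs => by linarith [hp _ hs]) hv
  simp only [neg_mul, neg_apply, inner_neg_right, Complex.neg_re] at this
  linarith

theorem mul_norm_le_of_mem_eigSpan {T : 𝓗 →L[ℂ] 𝓗} (hT : (T : 𝓗 →ₗ[ℂ] 𝓗).IsSymmetric)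
    {p : ℝ → Prop} {a : ℝ} (hp : ∀ s, p s → a ≤ s) {v : 𝓗} (hv : v ∈ eigSpan T p) :
    a * ‖v‖ ≤ ‖T v‖ := by
  rcases eq_or_ne v 0 with rfl | h0
  · simp
  have h1 := le_re_inner_of_mem_eigSpan hT hp hv
  have h2 : (inner ℂ v (T v)).re ≤ ‖v‖ * ‖T v‖ :=
    (Complex.re_le_norm _).trans (norm_inner_le_norm _ _)
  have h3 : 0 < ‖v‖ := norm_pos_iff.2 h0
  nlinarith

/-- A compact operator is bounded below only on finite-dimensional spaces. -/
theorem finiteDimensional_eigSpan {T : 𝓗 →L[ℂ] 𝓗} (hc : IsCompactOperator T)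
    (hT : (T : 𝓗 →ₗ[ℂ] 𝓗).IsSymmetric) {p : ℝ → Prop} {a : ℝ} (ha : 0 < a)
    (hp : ∀ s, p s → a ≤ s) : FiniteDimensional ℂ (eigSpan T p) := by
  set S : eigSpan T p →L[ℂ] 𝓗 := T ∘L (eigSpan T p).subtypeL
  have hanti : AntilipschitzWith (Real.toNNReal a⁻¹) S := by
    refine AddMonoidHomClass.antilipschitz_of_bound S fun v => ?_
    have := mul_norm_le_of_mem_eigSpan hT hp v.2
    rw [Real.coe_toNNReal _ (by positivity), inv_mul_eq_div, le_div_iff₀ ha, mul_comm]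
    exact this
  have hind := hanti.isUniformInducing S.uniformContinuous
  refine .of_totallyBounded_nhds_zero ℂ (Metric.closedBall_mem_nhds 0 one_pos) ?_
  have hSc : IsCompactOperator S := hc.comp_clm _
  rw [← totallyBounded_image_iff hind]
  exact ((isCompactOperator_iff_isCompact_closure_image_closedBall
    (S : eigSpan T p →ₗ[ℂ] 𝓗) one_pos).1 hSc).totallyBounded.subset subset_closure

variable [CompleteSpace 𝓗]

/-- The spectral theorem yields that the complement of the eigenvectors for eigenvalues `≥ t`
is the closed span of the other ones. -/
theorem re_inner_le_of_mem_orthogonal {T : 𝓗 →L[ℂ] 𝓗} (hc : IsCompactOperator T)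
    (hT : (T : 𝓗 →ₗ[ℂ] 𝓗).IsSymmetric) {t : ℝ} {v : 𝓗}
    (hv : v ∈ (eigSpan T (fun s => t ≤ s))ᗮ) :
    (inner ℂ v (T v)).re ≤ t * ‖v‖ ^ 2 := by
  set E := eigSpan T (fun s => t ≤ s)
  set L := eigSpan T (fun s => s < t)
  have hLE : L ≤ Eᗮ := by
    refine iSup_le fun s => Submodule.isOrtho_iff_le.1 (Submodule.isOrtho_iSup_right.2 fun r => ?_)
    have hne : ((s : ℝ) : ℂ) ≠ ((r : ℝ) : ℂ) := fun h =>
      (s.2.trans_le r.2).ne (Complex.ofReal_injective h)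
    rw [eigSpace_eq_eigenspace, eigSpace_eq_eigenspace]
    exact hT.orthogonalFamily_eigenspaces.isOrtho hne
  -- `E ⊔ L` contains all eigenspaces, the eigenvalues being real.
  have hbot : Eᗮ ⊓ Lᗮ ≤ ⊥ := by
    rw [Submodule.inf_orthogonal]
    rw [← ContinuousLinearMap.orthogonalComplement_iSup_eigenspaces_eq_bot hc hT]
    refine Submodule.orthogonal_le (iSup_le fun z => ?_)
    by_cases hz : Module.End.HasEigenvalue (T : Module.End ℂ 𝓗) z
    · have := hT.conj_eigenvalue_eq_self hz
      obtain ⟨r, rfl⟩ := Complex.conj_eq_iff_real.1 this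
      rw [← eigSpace_eq_eigenspace]
      rcases le_or_gt t r with h | h
      · exact (eigSpace_le_eigSpan (p := fun s => t ≤ s) T h).trans le_sup_left
      · exact (eigSpace_le_eigSpan (p := fun s => s < t) T h).trans le_sup_right
    · rw [Module.End.hasEigenvalue_iff, not_not] at hz
      rw [hz]
      exact bot_le
  have hmem : v ∈ L.topologicalClosure := by
    obtain ⟨y, hy, z, hz, rfl⟩ := (L.topologicalClosure).exists_add_mem_mem_orthogonal v
    have hy' : y ∈ Eᗮ := (L.topologicalClosure_minimal hLE E.isClosed_orthogonal) hy
    have hz' : z ∈ Eᗮ := by simpa using Eᗮ.sub_mem hv hy'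
    have : z ∈ (⊥ : Submodule ℂ 𝓗) :=
      hbot ⟨hz', Submodule.orthogonal_le L.le_topologicalClosure hz⟩
    rw [Submodule.mem_bot] at this
    simpa [this] using hy
  have hcl : IsClosed {v : 𝓗 | (inner ℂ v (T v)).re ≤ t * ‖v‖ ^ 2} :=
    isClosed_le (by fun_prop) (by fun_prop)
  have hmem' : v ∈ closure (L : Set 𝓗) := hmem
  exact closure_minimal (fun w hw => re_inner_le_of_mem_eigSpan hT (fun s hs => le_of_lt hs) hw)
    hcl hmem'

theorem eigSpace_ne_bot_iff {T : 𝓗 →L[ℂ] 𝓗} (hc : IsCompactOperator T) {z : ℂ} (hz : z ≠ 0) :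
    eigSpace T z ≠ ⊥ ↔ z ∈ spectrum ℂ T := by
  rw [← hc.hasEigenvalue_iff_mem_spectrum hz, eigSpace_eq_eigenspace,
    Module.End.hasEigenvalue_iff]

/-- The max-min principle: a space of dimension `n + 1` on which the quadratic form of `T` is at
least `s > t` forces at least `n + 1` eigenvalues `≥ t`. -/
theorem le_rank_eigSpan {T : 𝓗 →L[ℂ] 𝓗} (hc : IsCompactOperator T)
    (hT : (T : 𝓗 →ₗ[ℂ] 𝓗).IsSymmetric) {n : ℕ} {s t : ℝ} (ht : 0 < t) (hst : t < s)
    (V : Submodule ℂ 𝓗) (hV : (n : Cardinal) ≤ Module.rank ℂ V)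
    (h : ∀ v ∈ V, s * ‖v‖ ^ 2 ≤ (inner ℂ v (T v)).re) :
    (n : Cardinal) ≤ Module.rank ℂ (eigSpan T (fun s => t ≤ s)) := by
  refine hV.trans ?_
  have := finiteDimensional_eigSpan hc hT (p := fun s => t ≤ s) ht (fun _ h => h)
  set E := eigSpan T (fun s => t ≤ s)
  -- A vector of `V` orthogonal to `E` has quadratic form both `≥ s‖v‖²` and `≤ t‖v‖²`, so the
  -- orthogonal projection embeds `V` into `E`.
  refine LinearMap.rank_le_of_injective
    ((E.orthogonalProjectionOnto : 𝓗 →ₗ[ℂ] E) ∘ₗ V.subtype) ?_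
  rw [injective_iff_map_eq_zero]
  rintro ⟨v, hv⟩ h0
  have h0' : E.orthogonalProjectionOnto v = 0 := h0
  rw [Submodule.orthogonalProjectionOnto_eq_zero_iff] at h0'
  have h1 := re_inner_le_of_mem_orthogonal hc hT h0'
  have h2 := h v hv
  have h3 : ‖v‖ = 0 := by
    by_contra hne
    have : 0 < ‖v‖ := lt_of_le_of_ne (norm_nonneg _) (Ne.symm hne)
    have : 0 < ‖v‖ ^ 2 := by positivity
    nlinarith
  simpa using h3

end Spectral

section Energies

variable {𝓗 : Type*} [NormedAddCommGroup 𝓗] [InnerProductSpace ℂ 𝓗]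

/-- The set whose supremum is `upperEigenvalue T n`. -/
def upperEigenvalueSet (T : 𝓗 →L[ℂ] 𝓗) (n : ℕ) : Set ℝ :=
  {t : ℝ | 0 < t ∧ ((n + 1 : ℕ) : Cardinal) ≤ Module.rank ℂ (eigSpan T (fun s => t ≤ s))}

theorem upperEigenvalue_eq (T : 𝓗 →L[ℂ] 𝓗) (n : ℕ) :
    upperEigenvalue T n = sSup (upperEigenvalueSet T n) := rfl

theorem bddAbove_upperEigenvalueSet (T : 𝓗 →L[ℂ] 𝓗) (n : ℕ) :
    BddAbove (upperEigenvalueSet T n) := by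
  refine ⟨‖T‖, fun t ht => ?_⟩
  by_contra! hlt
  have hbot : eigSpan T (fun s => t ≤ s) = ⊥ := by
    refine eq_bot_iff.2 (iSup_le fun s v hv => ?_)
    rw [mem_eigSpace] at hv
    have h1 : ‖T v‖ = s * ‖v‖ := by
      rw [hv, norm_smul, Complex.norm_real, Real.norm_of_nonneg (ht.1.le.trans s.2)]
    have h2 := T.le_opNorm v
    have h3 := s.2
    by_contra hne
    have : 0 < ‖v‖ := norm_pos_iff.2 hne
    nlinarith
  have := ht.2
  rw [hbot, rank_bot] at this
  simp at this

theorem upperEigenvalue_nonneg (T : 𝓗 →L[ℂ] 𝓗) (n : ℕ) : 0 ≤ upperEigenvalue T n :=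
  Real.sSup_nonneg fun _ h => h.1.le

/-- Outside the spectrum the eigenspans are locally constant in the threshold `t`, so the supremum
defining `upperEigenvalue` cannot be there. -/
theorem eigSpace_upperEigenvalue_ne_bot [CompleteSpace 𝓗] {T : 𝓗 →L[ℂ] 𝓗}
    (hc : IsCompactOperator T) {n : ℕ} (h0 : 0 < upperEigenvalue T n) :
    eigSpace T (upperEigenvalue T n : ℂ) ≠ ⊥ := by
  set l := upperEigenvalue T n with hl
  have hlc : (l : ℂ) ≠ 0 := by exact_mod_cast h0.ne'
  rw [eigSpace_ne_bot_iff hc hlc]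
  by_contra hns
  have hopen : IsOpen {s : ℝ | (s : ℂ) ∉ spectrum ℂ T} :=
    (spectrum.isClosed T).isOpen_compl.preimage Complex.continuous_ofReal
  obtain ⟨ε, hε, hball⟩ := Metric.isOpen_iff.1 hopen l hns
  have hne : (upperEigenvalueSet T n).Nonempty := by
    by_contra hemp
    rw [Set.not_nonempty_iff_eq_empty] at hemp
    rw [hl, upperEigenvalue_eq, hemp, Real.sSup_empty] at h0
    exact lt_irrefl _ h0
  obtain ⟨t, ht, htl⟩ := exists_lt_of_lt_csSup hne (show l - ε < sSup (upperEigenvalueSet T n) by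
    rw [← upperEigenvalue_eq, ← hl]; linarith)
  have hmem : l + ε / 2 ∈ upperEigenvalueSet T n := by
    refine ⟨by positivity, ht.2.trans (Submodule.rank_mono (eigSpan_mono T fun s hs hsb => ?_))⟩
    by_contra! hlt
    have hs0 : (s : ℂ) ≠ 0 := by exact_mod_cast (ht.1.trans_le hs).ne'
    refine hball (a := s) ?_ ((eigSpace_ne_bot_iff hc hs0).1 hsb)
    rw [Metric.mem_ball, Real.dist_eq, abs_lt]
    constructor <;> linarith
  have := le_csSup (bddAbove_upperEigenvalueSet T n) hmem
  rw [← upperEigenvalue_eq, ← hl] at this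
  linarith

/-- A positive eigenvalue is the `n`-th largest one, where `n + 1` is the number of eigenvalues
that are not smaller. -/
theorem exists_upperEigenvalue_eq {T : 𝓗 →L[ℂ] 𝓗} (hc : IsCompactOperator T)
    (hT : (T : 𝓗 →ₗ[ℂ] 𝓗).IsSymmetric) {l : ℝ} (hl : 0 < l) (hne : eigSpace T (l : ℂ) ≠ ⊥) :
    ∃ n, upperEigenvalue T n = l := by
  have := finiteDimensional_eigSpan hc hT (p := fun s => l ≤ s) hl (fun _ h => h)
  set E := eigSpan T (fun s => l ≤ s) with hE
  have hle : eigSpace T (l : ℂ) ≤ E := eigSpace_le_eigSpan T le_rfl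
  have hpos : Module.finrank ℂ E ≠ 0 := by
    intro h
    rw [Submodule.finrank_eq_zero] at h
    exact hne (eq_bot_iff.2 (hle.trans h.le))
  obtain ⟨n, hn⟩ := Nat.exists_eq_succ_of_ne_zero hpos
  refine ⟨n, ?_⟩
  have hmem : l ∈ upperEigenvalueSet T n :=
    ⟨hl, by rw [← hE, ← Module.finrank_eq_rank, hn]⟩
  refine le_antisymm (csSup_le ⟨l, hmem⟩ fun t ht => ?_)
    (le_csSup (bddAbove_upperEigenvalueSet T n) hmem)
  by_contra! hlt
  -- For `t > l` the span loses the eigenvectors for `l`, so its dimension is at most `n`.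
  have hlt' : eigSpan T (fun s => t ≤ s) < E := by
    refine lt_of_le_of_ne (eigSpan_mono T fun s hs _ => hlt.le.trans hs) fun heq => ?_
    obtain ⟨v, hv, hv0⟩ := Submodule.exists_mem_ne_zero_of_ne_bot hne
    have h1 := le_re_inner_of_mem_eigSpan hT (p := fun s => t ≤ s) (a := t) (fun _ h => h)
      (heq.symm.le (hle hv))
    have h2 := re_inner_le_of_mem_eigSpan hT (p := fun s => s = l) (a := l) (fun _ h => h.le)
      (eigSpace_le_eigSpan (p := fun s => s = l) T (s := l) rfl hv)
    have : 0 < ‖v‖ ^ 2 := by have := norm_pos_iff.2 hv0; positivity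
    have := mul_lt_mul_of_pos_right hlt this
    linarith
  have h1 := Submodule.finrank_lt_finrank_of_lt hlt'
  have : FiniteDimensional ℂ (eigSpan T (fun s => t ≤ s)) :=
    Submodule.finiteDimensional_of_le hlt'.le
  have h2 : ((n + 1 : ℕ) : Cardinal) ≤ Module.rank ℂ (eigSpan T (fun s => t ≤ s)) := ht.2
  rw [← Module.finrank_eq_rank, Nat.cast_le] at h2
  omega

/-- The nonzero points of the spectrum are the nonzero values of the eigenvalue enumeration. -/
theorem mem_spectrum_iff_exists_eigenvalueSeq_eq [CompleteSpace 𝓗] {T : 𝓗 →L[ℂ] 𝓗}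
    (hc : IsCompactOperator T) (hT : (T : 𝓗 →ₗ[ℂ] 𝓗).IsSymmetric) {l : ℝ} (hl : l ≠ 0) :
    (l : ℂ) ∈ spectrum ℂ T ↔ ∃ n, eigenvalueSeq T n = l := by
  have hT' : ((-T : 𝓗 →L[ℂ] 𝓗) : 𝓗 →ₗ[ℂ] 𝓗).IsSymmetric := fun x y => by
    have := hT x y
    simpa using this
  have hc' : IsCompactOperator (-T : 𝓗 →L[ℂ] 𝓗) := hc.neg
  rw [← eigSpace_ne_bot_iff hc (Complex.ofReal_ne_zero.2 hl)]
  constructor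
  · intro h
    rcases hl.lt_or_gt with h0 | h0
    · rw [← eigSpace_neg, ← Complex.ofReal_neg] at h
      obtain ⟨n, hn⟩ := exists_upperEigenvalue_eq hc' hT' (neg_pos.2 h0) h
      exact ⟨Sum.inr n, by simp [eigenvalueSeq, hn]⟩
    · obtain ⟨n, hn⟩ := exists_upperEigenvalue_eq hc hT h0 h
      exact ⟨Sum.inl n, hn⟩
  · rintro ⟨n | n, rfl⟩
    · exact eigSpace_upperEigenvalue_ne_bot hc
        (lt_of_le_of_ne (upperEigenvalue_nonneg T n) (Ne.symm hl))
    · have h0 : 0 < upperEigenvalue (-T) n :=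
        lt_of_le_of_ne (upperEigenvalue_nonneg _ n) fun h => hl (by simp [eigenvalueSeq, ← h])
      have := eigSpace_upperEigenvalue_ne_bot hc' h0
      rw [eigenvalueSeq, Complex.ofReal_neg, ← eigSpace_neg, neg_neg]
      exact this

/-- By the max-min principle, `n + 1` eigenvalues of `T x` above a threshold persist, with an
arbitrarily small loss, for `T y` close to `T x` in norm. -/
theorem lowerSemicontinuous_upperEigenvalue [CompleteSpace 𝓗] {X : Type*} [TopologicalSpace X]
    {T : X → 𝓗 →L[ℂ] 𝓗} (hcont : Continuous T) (hc : ∀ x, IsCompactOperator (T x))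
    (hT : ∀ x, (T x : 𝓗 →ₗ[ℂ] 𝓗).IsSymmetric) (n : ℕ) :
    LowerSemicontinuous fun x => upperEigenvalue (T x) n := by
  intro x t htx
  rcases lt_or_ge t 0 with h0 | h0
  · exact Eventually.of_forall fun y => h0.trans_le (upperEigenvalue_nonneg _ _)
  replace htx : t < upperEigenvalue (T x) n := htx
  have hne : (upperEigenvalueSet (T x) n).Nonempty := by
    by_contra hemp
    rw [Set.not_nonempty_iff_eq_empty] at hemp
    rw [upperEigenvalue_eq, hemp, Real.sSup_empty] at htx
    exact absurd htx h0.not_gt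
  obtain ⟨s, hs, hts⟩ := exists_lt_of_lt_csSup hne htx
  filter_upwards [Metric.continuous_iff'.1 hcont x ((s - t) / 3) (by linarith)] with y hy
  have hmem : t + (s - t) / 3 ∈ upperEigenvalueSet (T y) n := by
    refine ⟨by linarith, le_rank_eigSpan (hc y) (hT y) (s := t + 2 * ((s - t) / 3))
      (by linarith) (by linarith) _ hs.2 fun v hv => ?_⟩
    have h1 := le_re_inner_of_mem_eigSpan (hT x) (fun _ h => h) hv
    have h2 : (inner ℂ v ((T x - T y) v)).re ≤ (s - t) / 3 * ‖v‖ ^ 2 := by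
      refine (Complex.re_le_norm _).trans ((norm_inner_le_norm _ _).trans ?_)
      have h3 := (T x - T y).le_opNorm v
      rw [dist_comm, dist_eq_norm] at hy
      nlinarith [norm_nonneg v, mul_le_mul_of_nonneg_right hy.le (norm_nonneg v)]
    rw [sub_apply, inner_sub_right, Complex.sub_re] at h2
    linarith
  have := le_csSup (bddAbove_upperEigenvalueSet (T y) n) hmem
  rw [← upperEigenvalue_eq] at this
  linarith

end Energies

/-! ### Disintegration along a real function -/

section Disintegration

variable {X : Type*} [MeasurableSpace X] [StandardBorelSpace X] [Nonempty X]

open ProbabilityTheory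

/-- The regular conditional distribution given `h` is a disintegration along `h`; it is carried by
the nonempty level sets after a modification for `t` in a null set. -/
theorem exists_isDisintegration_carried (μ : Measure X) [IsProbabilityMeasure μ] {h : X → ℝ}
    (hh : Measurable h) :
    ∃ κ : ℝ → Measure X, IsDisintegration μ h κ ∧
      ∀ t, {x | h x = t}.Nonempty → κ t {x | h x = t}ᶜ = 0 := by
  classical
  set K := condDistrib id h μ
  have hcomp : (μ.map h) ⊗ₘ K = μ.map (fun x => (h x, x)) :=
    compProd_map_condDistrib aemeasurable_id
  have hgraph : Measurable fun x => (h x, x) := hh.prodMk measurable_id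
  have hae : ∀ᵐ t ∂(μ.map h), K t {x | h x = t}ᶜ = 0 := by
    have hS : MeasurableSet {p : ℝ × X | h p.2 = p.1} :=
      measurableSet_eq_fun (hh.comp measurable_snd) measurable_fst
    have h1 : ∀ᵐ p ∂((μ.map h) ⊗ₘ K), h p.2 = p.1 := by
      rw [hcomp, ae_map_iff hgraph.aemeasurable hS]
      exact ae_of_all _ fun _ => rfl
    exact Measure.ae_ae_of_ae_compProd h1
  set κ : ℝ → Measure X := fun t =>
    if ht : {x | h x = t}.Nonempty ∧ K t {x | h x = t}ᶜ ≠ 0 then Measure.dirac ht.1.some else K t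
    with hκ
  have hκK : ∀ᵐ t ∂(μ.map h), κ t = K t := by
    filter_upwards [hae] with t ht
    simp only [hκ]
    rw [dif_neg (fun h' => h'.2 ht)]
  refine ⟨κ, ⟨fun t => ?_, fun ψ hψ => ?_⟩, fun t ht => ?_⟩
  · simp only [hκ]
    split_ifs <;> infer_instance
  · have hψ' : Integrable (fun p : ℝ × X => ψ p.2) (μ.map fun x => (h x, x)) := by
      have hm : μ = (μ.map fun x => (h x, x)).map Prod.snd := by
        rw [Measure.map_map measurable_snd hgraph]
        exact Measure.map_id.symm
      rw [hm] at hψ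
      exact hψ.comp_measurable measurable_snd
    have hae' : (fun t => ∫ x, ψ x ∂(K t)) =ᵐ[μ.map h] fun t => ∫ x, ψ x ∂(κ t) := by
      filter_upwards [hκK] with t ht
      rw [ht]
    refine ⟨(Integrable.integral_condDistrib_map (Y := id) aemeasurable_id hψ').congr hae', ?_⟩
    rintro φ hφ ⟨C, hC⟩
    have hψφ : Integrable (fun p : ℝ × X => ψ p.2 * φ p.1) (μ.map fun x => (h x, x)) :=
      hψ'.mul_bdd (c := C) (hφ.comp measurable_fst).aestronglyMeasurable
        (ae_of_all _ fun p => hC p.1)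
    calc ∫ x, ψ x * φ (h x) ∂μ
        = ∫ p, ψ p.2 * φ p.1 ∂(μ.map fun x => (h x, x)) :=
          (integral_map hgraph.aemeasurable hψφ.aestronglyMeasurable).symm
      _ = ∫ t, ∫ x, ψ x * φ t ∂(K t) ∂(μ.map h) := by
          rw [← hcomp] at hψφ ⊢
          exact Measure.integral_compProd hψφ
      _ = ∫ t, (∫ x, ψ x ∂(κ t)) * φ t ∂(μ.map h) := by
          refine integral_congr_ae ?_
          filter_upwards [hκK] with t ht
          rw [ht, integral_mul_const]
  · by_cases h' : {x | h x = t}.Nonempty ∧ K t {x | h x = t}ᶜ ≠ 0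
    · simp only [hκ]
      have hm : MeasurableSet {x | h x = t} := hh (measurableSet_singleton t)
      rw [dif_pos h', Measure.dirac_apply' _ hm.compl]
      have : h h'.1.some = t := h'.1.some_mem
      simp [this]
    · simp only [hκ]
      rw [dif_neg h']
      by_contra hne
      exact h' ⟨ht, hne⟩

end Disintegration

/-! ### The normalized trace on an eigenspace -/

section NormalizedTrace

variable {𝓗 : Type*} [NormedAddCommGroup 𝓗] [InnerProductSpace ℂ 𝓗]

/-- The normalized trace `A ↦ (dim E)⁻¹ ∑ ⟪eⱼ, A eⱼ⟫` of the compression of `A` to a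
finite-dimensional subspace `E`, with `e` an orthonormal basis of `E`. -/
def compressedTrace (E : Submodule ℂ 𝓗) [FiniteDimensional ℂ E] : (𝓗 →L[ℂ] 𝓗) →ₗ[ℂ] ℂ where
  toFun A := (Module.finrank ℂ E : ℂ)⁻¹ *
    ∑ j, inner ℂ (stdOrthonormalBasis ℂ E j : 𝓗) (A (stdOrthonormalBasis ℂ E j : 𝓗))
  map_add' A B := by
    simp only [add_apply, inner_add_right, Finset.sum_add_distrib, mul_add]
  map_smul' c A := by
    simp only [smul_apply, inner_smul_right, ← Finset.mul_sum, RingHom.id_apply, smul_eq_mul]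
    ring

theorem compressedTrace_apply (E : Submodule ℂ 𝓗) [FiniteDimensional ℂ E] (A : 𝓗 →L[ℂ] 𝓗) :
    compressedTrace E A = (Module.finrank ℂ E : ℂ)⁻¹ *
      ∑ j, inner ℂ (stdOrthonormalBasis ℂ E j : 𝓗) (A (stdOrthonormalBasis ℂ E j : 𝓗)) := rfl

theorem norm_coe_stdOrthonormalBasis (E : Submodule ℂ 𝓗) [FiniteDimensional ℂ E]
    (j : Fin (Module.finrank ℂ E)) : ‖(stdOrthonormalBasis ℂ E j : 𝓗)‖ = 1 :=
  (stdOrthonormalBasis ℂ E).orthonormal.1 j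

theorem norm_compressedTrace_le (E : Submodule ℂ 𝓗) [FiniteDimensional ℂ E] (A : 𝓗 →L[ℂ] 𝓗) :
    ‖compressedTrace E A‖ ≤ ‖A‖ := by
  have h : ‖∑ j, inner ℂ (stdOrthonormalBasis ℂ E j : 𝓗) (A (stdOrthonormalBasis ℂ E j : 𝓗))‖
      ≤ Module.finrank ℂ E * ‖A‖ := by
    refine (norm_sum_le_of_le (n := fun _ => ‖A‖) _ fun j _ => ?_).trans_eq (by simp)
    refine (norm_inner_le_norm _ _).trans ?_
    have := A.le_opNorm (stdOrthonormalBasis ℂ E j : 𝓗)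
    rw [norm_coe_stdOrthonormalBasis, mul_one] at this
    rwa [norm_coe_stdOrthonormalBasis, one_mul]
  rw [compressedTrace_apply, norm_mul, norm_inv, Complex.norm_natCast]
  rcases Nat.eq_zero_or_pos (Module.finrank ℂ E) with h0 | h0
  · simp [h0]
  · rw [inv_mul_le_iff₀ (by exact_mod_cast h0)]
    exact h

variable [CompleteSpace 𝓗]

theorem compressedTrace_isEigenstate (T : 𝓗 →L[ℂ] 𝓗) (z : ℂ) [FiniteDimensional ℂ (eigSpace T z)]
    (hne : eigSpace T z ≠ ⊥) : IsEigenstate (compressedTrace (eigSpace T z)) T z := by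
  have hd : (Module.finrank ℂ (eigSpace T z) : ℂ) ≠ 0 := by
    exact_mod_cast fun h => hne (Submodule.finrank_eq_zero.1 h)
  refine ⟨⟨fun A => ?_, ?_⟩, fun A => ?_⟩
  · rw [compressedTrace_apply]
    refine mul_nonneg (inv_nonneg.2 (Nat.cast_nonneg _)) (Finset.sum_nonneg fun j _ => ?_)
    rw [ContinuousLinearMap.star_eq_adjoint, mul_apply_eq_comp,
      ContinuousLinearMap.adjoint_inner_right, inner_self_eq_norm_sq_to_K]
    exact pow_nonneg (Complex.zero_le_real.2 (norm_nonneg (A _))) 2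
  · rw [compressedTrace_apply]
    simp [inner_self_eq_norm_sq_to_K, norm_coe_stdOrthonormalBasis, hd]
  · simp only [compressedTrace_apply, mul_apply_eq_comp]
    have (j : _) : T (stdOrthonormalBasis ℂ (eigSpace T z) j : 𝓗)
        = z • (stdOrthonormalBasis ℂ (eigSpace T z) j : 𝓗) :=
      mem_eigSpace.1 (stdOrthonormalBasis ℂ (eigSpace T z) j).2
    simp only [this, map_smul, inner_smul_right, ← Finset.mul_sum]
    ring

/-- In every orthonormal basis, the diagonal of `P A`, with `P` a finite rank projection, sums to
the trace of the compression of `A` to the range of `P`. -/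
theorem hasSum_inner_starProjection_mul (E : Submodule ℂ 𝓗) [FiniteDimensional ℂ E]
    (A : 𝓗 →L[ℂ] 𝓗) {ι : Type*} (b : HilbertBasis ι ℂ 𝓗) :
    HasSum (fun i => inner ℂ (b i) ((E.starProjection * A) (b i)))
      (∑ j, inner ℂ (stdOrthonormalBasis ℂ E j : 𝓗) (A (stdOrthonormalBasis ℂ E j : 𝓗))) := by
  have hP (w : 𝓗) : E.starProjection w = ∑ j, inner ℂ (stdOrthonormalBasis ℂ E j : 𝓗) w •
      (stdOrthonormalBasis ℂ E j : 𝓗) := by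
    rw [(stdOrthonormalBasis ℂ E).starProjection_eq_sum_rankOne]
    simp
  have e : (fun i => inner ℂ (b i) ((E.starProjection * A) (b i))) = fun i => ∑ j,
      inner ℂ (ContinuousLinearMap.adjoint A (stdOrthonormalBasis ℂ E j : 𝓗)) (b i) *
        inner ℂ (b i) (stdOrthonormalBasis ℂ E j : 𝓗) := by
    funext i
    rw [mul_apply_eq_comp, hP]
    simp only [inner_sum, inner_smul_right, ContinuousLinearMap.adjoint_inner_left]
  rw [e]
  simp only [← ContinuousLinearMap.adjoint_inner_left A]
  exact hasSum_sum fun j _ => b.hasSum_inner_mul_inner _ _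

theorem hasSum_inner_spectralProj_mul (T : 𝓗 →L[ℂ] 𝓗) (z : ℂ)
    [FiniteDimensional ℂ (eigSpace T z)]
    (A : 𝓗 →L[ℂ] 𝓗) {ι : Type*} (b : HilbertBasis ι ℂ 𝓗) :
    HasSum (fun i => inner ℂ (b i) ((spectralProj T z * A) (b i)))
      (Module.finrank ℂ (eigSpace T z) * compressedTrace (eigSpace T z) A) := by
  have e : Module.finrank ℂ (eigSpace T z) * compressedTrace (eigSpace T z) A =
      ∑ j, inner ℂ (stdOrthonormalBasis ℂ (eigSpace T z) j : 𝓗)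
        (A (stdOrthonormalBasis ℂ (eigSpace T z) j : 𝓗)) := by
    rw [compressedTrace_apply]
    rcases eq_or_ne (Module.finrank ℂ (eigSpace T z)) 0 with h0 | h0
    · have : IsEmpty (Fin (Module.finrank ℂ (eigSpace T z))) := by rw [h0]; infer_instance
      simp
    · rw [mul_inv_cancel_left₀ (by exact_mod_cast h0)]
  rw [e]
  exact hasSum_inner_starProjection_mul (eigSpace T z) A b

theorem opTrace_spectralProj_mul (T : 𝓗 →L[ℂ] 𝓗) (z : ℂ) [FiniteDimensional ℂ (eigSpace T z)]
    (A : 𝓗 →L[ℂ] 𝓗) : opTrace (spectralProj T z * A) =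
      Module.finrank ℂ (eigSpace T z) * compressedTrace (eigSpace T z) A :=
  (hasSum_inner_spectralProj_mul T z A _).tsum_eq

theorem opTrace_zero : opTrace (0 : 𝓗 →L[ℂ] 𝓗) = 0 := by
  simp [opTrace]

theorem opTrace_smul (c : ℂ) (A : 𝓗 →L[ℂ] 𝓗) : opTrace (c • A) = c * opTrace A := by
  simp only [opTrace, smul_apply, inner_smul_right, tsum_mul_left]

theorem opTrace_normalized_spectralProj_mul (T : 𝓗 →L[ℂ] 𝓗) (z : ℂ)
    [FiniteDimensional ℂ (eigSpace T z)] (hne : eigSpace T z ≠ ⊥) (A : 𝓗 →L[ℂ] 𝓗) :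
    opTrace (((opTrace (spectralProj T z))⁻¹ • spectralProj T z) * A) =
      compressedTrace (eigSpace T z) A := by
  have hd : (Module.finrank ℂ (eigSpace T z) : ℂ) ≠ 0 := by
    exact_mod_cast fun h => hne (Submodule.finrank_eq_zero.1 h)
  have h1 := opTrace_spectralProj_mul T z 1
  rw [mul_one, (compressedTrace_isEigenstate T z hne).isState.map_one, mul_one] at h1
  rw [smul_mul_assoc, opTrace_smul, opTrace_spectralProj_mul, h1, inv_mul_cancel_left₀ hd]

end NormalizedTrace

/-! ### Measurability of spectral projections -/

section Measurability

variable {𝓗 : Type*} [NormedAddCommGroup 𝓗] [InnerProductSpace ℂ 𝓗]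

theorem countable_of_hilbertBasis [TopologicalSpace.SeparableSpace 𝓗] {ι : Type*}
    (b : HilbertBasis ι ℂ 𝓗) : Countable ι := by
  refine Pairwise.countable_of_isOpen_disjoint (s := fun i => Metric.ball (b i) (1 / 2)) ?_
    (fun i => Metric.isOpen_ball) (fun i => ⟨b i, Metric.mem_ball_self (by norm_num)⟩)
  intro i j hij
  refine Metric.ball_disjoint_ball ?_
  have h : ‖b i - b j‖ ^ 2 = 2 := by
    rw [norm_sub_sq (𝕜 := ℂ), b.orthonormal.2 hij, b.orthonormal.1 i, b.orthonormal.1 j]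
    norm_num
  rw [dist_eq_norm]
  nlinarith [norm_nonneg (b i - b j)]

variable [CompleteSpace 𝓗]

theorem inner_mul_self_apply {K : 𝓗 →L[ℂ] 𝓗} (hK : IsSelfAdjoint K) (v : 𝓗) :
    inner ℂ v ((K * K) v) = (‖K v‖ : ℂ) ^ 2 := by
  have := hK.isSymmetric v (K v)
  rw [mul_apply_eq_comp]
  exact this.symm.trans (inner_self_eq_norm_sq_to_K _)

/-- For a self-adjoint `K` with `‖K‖² ≤ C`, the operator `1 - K² / C` is a contraction. -/
theorem norm_one_sub_smul_sq_le {K : 𝓗 →L[ℂ] 𝓗} (hK : IsSelfAdjoint K) {C : ℝ} (hC : 0 < C)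
    (hKC : ‖K‖ ^ 2 ≤ C) : ‖1 - ((C⁻¹ : ℝ) : ℂ) • (K * K)‖ ≤ 1 := by
  refine ContinuousLinearMap.opNorm_le_bound _ zero_le_one fun v => ?_
  rw [one_mul]
  refine le_of_sq_le_sq ?_ (norm_nonneg _)
  have e : (1 - ((C⁻¹ : ℝ) : ℂ) • (K * K)) v = v - ((C⁻¹ : ℝ) : ℂ) • ((K * K) v) := rfl
  rw [e, norm_sub_sq (𝕜 := ℂ), inner_smul_right, inner_mul_self_apply hK, norm_smul,
    Complex.norm_real, Real.norm_of_nonneg (by positivity)]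
  have e2 : RCLike.re (((C⁻¹ : ℝ) : ℂ) * (‖K v‖ : ℂ) ^ 2) = C⁻¹ * ‖K v‖ ^ 2 := by
    rw [← Complex.ofReal_pow, ← Complex.ofReal_mul]
    exact Complex.ofReal_re _
  rw [e2]
  have h1 : ‖(K * K) v‖ ^ 2 ≤ C * ‖K v‖ ^ 2 := by
    have := K.le_opNorm (K v)
    calc ‖(K * K) v‖ ^ 2 ≤ (‖K‖ * ‖K v‖) ^ 2 := by gcongr; exact this
      _ = ‖K‖ ^ 2 * ‖K v‖ ^ 2 := by ring
      _ ≤ C * ‖K v‖ ^ 2 := by gcongr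
  have h2 : (C⁻¹ * ‖(K * K) v‖) ^ 2 ≤ C⁻¹ * ‖K v‖ ^ 2 := by
    calc (C⁻¹ * ‖(K * K) v‖) ^ 2 = C⁻¹ ^ 2 * ‖(K * K) v‖ ^ 2 := by ring
      _ ≤ C⁻¹ ^ 2 * (C * ‖K v‖ ^ 2) := by gcongr
      _ = C⁻¹ * ‖K v‖ ^ 2 := by field_simp
  have h3 : 0 ≤ C⁻¹ * ‖K v‖ ^ 2 := by positivity
  linarith

theorem eqLocus_one_sub_smul_sq {K : 𝓗 →L[ℂ] 𝓗} (hK : IsSelfAdjoint K) {C : ℝ} (hC : 0 < C)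
    (v : 𝓗) : (1 - ((C⁻¹ : ℝ) : ℂ) • (K * K)) v = v ↔ K v = 0 := by
  have e : (1 - ((C⁻¹ : ℝ) : ℂ) • (K * K)) v = v - ((C⁻¹ : ℝ) : ℂ) • ((K * K) v) := rfl
  have hC' : ((C⁻¹ : ℝ) : ℂ) ≠ 0 := by exact_mod_cast (inv_pos.2 hC).ne'
  rw [e, sub_eq_self, smul_eq_zero, or_iff_right hC']
  constructor
  · intro h
    have := inner_mul_self_apply hK v
    rw [h, inner_zero_right] at this
    simpa using this.symm
  · intro h
    rw [mul_apply_eq_comp, h, map_zero]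

theorem isSelfAdjoint_sub_real {T : 𝓗 →L[ℂ] 𝓗} (hT : IsSelfAdjoint T) (l : ℝ) :
    IsSelfAdjoint (T - (l : ℂ) • (1 : 𝓗 →L[ℂ] 𝓗)) :=
  hT.sub (IsSelfAdjoint.smul (Complex.conj_ofReal l : IsSelfAdjoint (l : ℂ)) (IsSelfAdjoint.one _))

/-- The polynomial `1 - (T - l)² / C` in `T`: it takes the value `1` on the eigenvectors for the
eigenvalue `l` and, for `C` large, values in `[0, 1)` on the rest of the spectrum. -/
def peakOperator (T : 𝓗 →L[ℂ] 𝓗) (l C : ℝ) : 𝓗 →L[ℂ] 𝓗 :=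
  1 - ((C⁻¹ : ℝ) : ℂ) • ((T - (l : ℂ) • (1 : 𝓗 →L[ℂ] 𝓗)) * (T - (l : ℂ) • (1 : 𝓗 →L[ℂ] 𝓗)))

theorem norm_peakOperator_le {T : 𝓗 →L[ℂ] 𝓗} (hT : IsSelfAdjoint T) {l C : ℝ}
    (hC : 0 < C) (hTC : ‖T - (l : ℂ) • (1 : 𝓗 →L[ℂ] 𝓗)‖ ^ 2 ≤ C) : ‖peakOperator T l C‖ ≤ 1 :=
  norm_one_sub_smul_sq_le (isSelfAdjoint_sub_real hT l) hC hTC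

/-- A factor `T - l` on the right annihilates the eigenstate, so only the constant term `1` of the
expansion of `(1 - (T - l)² / C)ⁿ` in powers of `T - l` contributes. -/
theorem IsEigenstate.map_peakOperator_pow {T : 𝓗 →L[ℂ] 𝓗} {l : ℝ} {τ : (𝓗 →L[ℂ] 𝓗) →ₗ[ℂ] ℂ}
    (hτ : IsEigenstate τ T l) {C : ℝ} (n : ℕ) : τ (peakOperator T l C ^ n) = 1 := by
  have hK (B : 𝓗 →L[ℂ] 𝓗) : τ (B * (T - (l : ℂ) • (1 : 𝓗 →L[ℂ] 𝓗))) = 0 := by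
    rw [mul_sub, map_sub, hτ.map_mul, mul_smul_comm, mul_one, map_smul, smul_eq_mul, sub_self]
  induction n with
  | zero => rw [pow_zero, hτ.isState.map_one]
  | succ n ih =>
    rw [pow_succ]
    nth_rw 2 [peakOperator]
    rw [mul_sub, mul_one, mul_smul_comm, ← mul_assoc, map_sub, map_smul, hK, smul_zero,
      sub_zero, ih]

/-- By the mean ergodic theorem, the Birkhoff averages of the contraction `1 - (T - l)² / C`
converge to the spectral projection of `T` for the eigenvalue `l`. -/
theorem tendsto_birkhoffAverage_spectralProj {T : 𝓗 →L[ℂ] 𝓗} (hT : IsSelfAdjoint T) {l C : ℝ}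
    (hC : 0 < C) (hTC : ‖T - (l : ℂ) • (1 : 𝓗 →L[ℂ] 𝓗)‖ ^ 2 ≤ C) (v : 𝓗) :
    Tendsto (fun N => birkhoffAverage ℂ (peakOperator T l C) id N v)
      atTop (𝓝 (spectralProj T l v)) := by
  have hE : eigSpace T l = (peakOperator T l C).eqLocus (1 : 𝓗 →L[ℂ] 𝓗) := by
    ext w
    rw [mem_eigSpace]
    refine Iff.trans ?_ (eqLocus_one_sub_smul_sq (isSelfAdjoint_sub_real hT l) hC w).symm
    rw [sub_apply, sub_eq_zero]
    rfl
  have hP : spectralProj T l v =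
      ((peakOperator T l C).eqLocus (1 : 𝓗 →L[ℂ] 𝓗)).orthogonalProjectionOnto v := by
    rw [← Submodule.starProjection_apply]
    unfold spectralProj
    congr!
  rw [hP]
  exact ContinuousLinearMap.tendsto_birkhoffAverage_orthogonalProjection _
    (norm_peakOperator_le hT hC hTC) v

variable {X : Type*} [TopologicalSpace X] [CompactSpace X] [MeasurableSpace X]
  [OpensMeasurableSpace X]

theorem measurable_inner_spectralProj {T : X → 𝓗 →L[ℂ] 𝓗} (hcont : Continuous T)
    (hT : ∀ x, IsSelfAdjoint (T x)) (l : ℝ) (u : 𝓗) {w : X → 𝓗} (hw : Continuous w) :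
    Measurable fun x => inner ℂ u (spectralProj (T x) l (w x)) := by
  have hK : Continuous fun x => T x - (l : ℂ) • (1 : 𝓗 →L[ℂ] 𝓗) := by fun_prop
  obtain ⟨R, hR⟩ := isCompact_univ.exists_bound_of_continuousOn hK.continuousOn
  have hC : 0 < R ^ 2 + 1 := by positivity
  have hconv (x : X) := tendsto_birkhoffAverage_spectralProj (hT x) (l := l) hC
    (by have := hR x trivial; have h0 := norm_nonneg (T x - (l : ℂ) • (1 : 𝓗 →L[ℂ] 𝓗)); nlinarith)
    (w x)
  refine measurable_of_tendsto_metrizable (f := fun N x => inner ℂ u (birkhoffAverage ℂ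
    (peakOperator (T x) l (R ^ 2 + 1)) id N (w x))) (fun N => ?_)
    (tendsto_pi_nhds.2 fun x => tendsto_const_nhds.inner (hconv x))
  refine Continuous.measurable (continuous_const.inner ?_)
  simp only [birkhoffAverage, birkhoffSum, id]
  refine continuous_const.smul (continuous_finsetSum _ fun n _ => ?_)
  simp only [← FunLike.coe_pow_eq_iterate, peakOperator]
  fun_prop

theorem measurable_opTrace_spectralProj_mul [TopologicalSpace.SeparableSpace 𝓗]
    {T : X → 𝓗 →L[ℂ] 𝓗} (hcont : Continuous T) (hT : ∀ x, IsSelfAdjoint (T x)) (l : ℝ)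
    (hfin : ∀ x, FiniteDimensional ℂ (eigSpace (T x) l)) {A : X → 𝓗 →L[ℂ] 𝓗}
    (hA : Continuous A) : Measurable fun x => opTrace (spectralProj (T x) l * A x) := by
  obtain ⟨w, b, -⟩ := exists_hilbertBasis ℂ 𝓗
  have := countable_of_hilbertBasis b
  refine measurable_of_tendsto_metrizable' atTop (f := fun (s : Finset w) x =>
    ∑ i ∈ s, inner ℂ (b i) ((spectralProj (T x) l * A x) (b i))) (fun s => ?_)
    (tendsto_pi_nhds.2 fun x => ?_)
  · refine Finset.measurable_fun_sum _ fun i _ => ?_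
    exact measurable_inner_spectralProj hcont hT l (b i) (w := fun x => A x (b i)) (by fun_prop)
  · rw [opTrace_spectralProj_mul]
    exact hasSum_inner_spectralProj_mul (T x) l (A x) b

end Measurability

/-! ### Continuous families of compact operators -/

section Families

variable {𝓗 : Type*} [NormedAddCommGroup 𝓗] [InnerProductSpace ℂ 𝓗] [CompleteSpace 𝓗]

namespace CompactOp

variable (𝓗) in
/-- The inclusion of the compact operators into the bounded operators. -/
def toCLMHom : CompactOp 𝓗 →⋆ₙₐ[ℂ] (𝓗 →L[ℂ] 𝓗) where
  toFun := toCLM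
  map_smul' _ _ := rfl
  map_zero' := rfl
  map_add' _ _ := rfl
  map_mul' _ _ := rfl
  map_star' _ := rfl

theorem isCompactOperator (T : CompactOp 𝓗) : IsCompactOperator (T : 𝓗 →L[ℂ] 𝓗) := T.2

theorem norm_toCLM (T : CompactOp 𝓗) : ‖(T : 𝓗 →L[ℂ] 𝓗)‖ = ‖T‖ := rfl

theorem isometry_toCLM : Isometry (toCLM : CompactOp 𝓗 → 𝓗 →L[ℂ] 𝓗) :=
  AddMonoidHomClass.isometry_of_norm (toCLMHom 𝓗) norm_toCLM

theorem toCLM_injective : Function.Injective (toCLM : CompactOp 𝓗 → 𝓗 →L[ℂ] 𝓗) :=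
  isometry_toCLM.injective

end CompactOp

variable {X : Type*} [TopologicalSpace X]

theorem continuous_toCLM_comp (A : C(X, CompactOp 𝓗)) :
    Continuous fun x => (A x : 𝓗 →L[ℂ] 𝓗) :=
  CompactOp.isometry_toCLM.continuous.comp A.continuous

/-- The evaluation `A + c ↦ A(x) + c` of an element of the unitization of `C(X, 𝔎)`. -/
def evalHom (x : X) : Unitization ℂ C(X, CompactOp 𝓗) →⋆ₐ[ℂ] (𝓗 →L[ℂ] 𝓗) :=
  Unitization.starLift
    { toFun := fun A => (A x : 𝓗 →L[ℂ] 𝓗)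
      map_smul' := fun _ _ => rfl
      map_zero' := rfl
      map_add' := fun _ _ => rfl
      map_mul' := fun _ _ => rfl
      map_star' := fun _ => rfl }

theorem evalHom_apply (x : X) (z : Unitization ℂ C(X, CompactOp 𝓗)) :
    evalHom x z = z.fst • (1 : 𝓗 →L[ℂ] 𝓗) + (z.snd x : 𝓗 →L[ℂ] 𝓗) := by
  rw [← Algebra.algebraMap_eq_smul_one]
  rfl

theorem evalHom_inr (x : X) (A : C(X, CompactOp 𝓗)) :
    evalHom x (A : Unitization ℂ C(X, CompactOp 𝓗)) = (A x : 𝓗 →L[ℂ] 𝓗) := by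
  rw [evalHom_apply]
  simp

theorem unitization_ext {z w : Unitization ℂ C(X, CompactOp 𝓗)} (h1 : z.fst = w.fst)
    (h2 : ∀ x, evalHom x z = evalHom x w) : z = w := by
  refine Unitization.ext h1 (ContinuousMap.ext fun x => CompactOp.toCLM_injective ?_)
  have := h2 x
  rw [evalHom_apply, evalHom_apply, h1] at this
  exact add_left_cancel this

theorem isSelfAdjoint_apply {H : C(X, CompactOp 𝓗)} (hH : IsSelfAdjoint H) (x : X) :
    IsSelfAdjoint (H x : 𝓗 →L[ℂ] 𝓗) :=
  congrArg (fun A : C(X, CompactOp 𝓗) => (A x : 𝓗 →L[ℂ] 𝓗)) hH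

/-- If `H(x) - l` is invertible for every `x`, then `l⁻¹ (1 + (l - H(x))⁻¹ H(x))` is a continuous
inverse of `l - H(x)` in the unitization, because `(l - H(x))⁻¹ H(x)` is compact. -/
theorem fermiSurface_nonempty {H : C(X, CompactOp 𝓗)} {l : ℝ} (hl0 : l ≠ 0)
    (hl : (l : ℂ) ∈ spectrum ℂ (H : Unitization ℂ C(X, CompactOp 𝓗))) :
    (fermiSurface H l).Nonempty := by
  by_contra hemp
  rw [Set.not_nonempty_iff_eq_empty, Set.eq_empty_iff_forall_notMem] at hemp
  have hlc : (l : ℂ) ≠ 0 := Complex.ofReal_ne_zero.2 hl0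
  have hunit (x : X) : IsUnit ((l : ℂ) • (1 : 𝓗 →L[ℂ] 𝓗) - (H x : 𝓗 →L[ℂ] 𝓗)) := by
    have := spectrum.notMem_iff.1 (hemp x)
    rwa [Algebra.algebraMap_eq_smul_one] at this
  set R : X → 𝓗 →L[ℂ] 𝓗 := fun x =>
    Ring.inverse ((l : ℂ) • (1 : 𝓗 →L[ℂ] 𝓗) - (H x : 𝓗 →L[ℂ] 𝓗))
  have hRcont : Continuous R := by
    refine continuous_iff_continuousAt.2 fun x => ?_
    obtain ⟨u, hu⟩ := hunit x
    have h1 := NormedRing.inverse_continuousAt u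
    rw [hu] at h1
    exact ContinuousAt.comp (f := fun y => (l : ℂ) • (1 : 𝓗 →L[ℂ] 𝓗) - (H y : 𝓗 →L[ℂ] 𝓗)) h1
      (continuous_const.sub (continuous_toCLM_comp H)).continuousAt
  let Y : C(X, CompactOp 𝓗) :=
    { toFun := fun x => ⟨(l : ℂ)⁻¹ • (R x * (H x : 𝓗 →L[ℂ] 𝓗)),
        IsCompactOperator.smul ((H x).isCompactOperator.clm_comp (R x)) _⟩
      continuous_toFun := by
        refine CompactOp.isometry_toCLM.isUniformInducing.isInducing.continuous_iff.2 ?_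
        exact (hRcont.mul (continuous_toCLM_comp H)).const_smul (l : ℂ)⁻¹ }
  have hY (x : X) : evalHom x ((l : ℂ)⁻¹ • 1 + (Y : Unitization ℂ C(X, CompactOp 𝓗))) =
      (l : ℂ)⁻¹ • (1 + R x * (H x : 𝓗 →L[ℂ] 𝓗)) := by
    rw [map_add, map_smul, map_one, evalHom_inr, smul_add]
    rfl
  have hH (x : X) : evalHom x (algebraMap ℂ _ (l : ℂ) - (H : Unitization ℂ C(X, CompactOp 𝓗))) =
      (l : ℂ) • (1 : 𝓗 →L[ℂ] 𝓗) - (H x : 𝓗 →L[ℂ] 𝓗) := by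
    rw [map_sub, AlgHomClass.commutes, evalHom_inr, Algebra.algebraMap_eq_smul_one]
  have hfst : (algebraMap ℂ _ (l : ℂ) - (H : Unitization ℂ C(X, CompactOp 𝓗))).fst = (l : ℂ) :=
    sub_zero _
  refine hl ⟨⟨_, (l : ℂ)⁻¹ • 1 + (Y : Unitization ℂ C(X, CompactOp 𝓗)),
    unitization_ext ?_ fun x => ?_, unitization_ext ?_ fun x => ?_⟩, rfl⟩
  · rw [Unitization.fst_mul, hfst]
    simp [hlc]
  · have hinv := Ring.mul_inverse_cancel _ (hunit x)
    rw [map_mul, hY, hH, map_one, mul_smul_comm, mul_add, ← mul_assoc, hinv, mul_one, one_mul,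
      sub_add_cancel, smul_smul, inv_mul_cancel₀ hlc, one_smul]
  · rw [Unitization.fst_mul, hfst]
    simp [hlc]
  · have hinv := Ring.inverse_mul_cancel _ (hunit x)
    have hcomm : (H x : 𝓗 →L[ℂ] 𝓗) * ((l : ℂ) • (1 : 𝓗 →L[ℂ] 𝓗) - (H x : 𝓗 →L[ℂ] 𝓗)) =
        ((l : ℂ) • (1 : 𝓗 →L[ℂ] 𝓗) - (H x : 𝓗 →L[ℂ] 𝓗)) * (H x : 𝓗 →L[ℂ] 𝓗) := by
      simp [mul_sub, sub_mul]
    rw [map_mul, hY, hH, map_one, smul_mul_assoc, add_mul, mul_assoc, hcomm, ← mul_assoc, hinv,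
      one_mul, one_mul, sub_add_cancel, smul_smul, inv_mul_cancel₀ hlc, one_smul]

theorem measurable_energy [MeasurableSpace X] [BorelSpace X] {H : C(X, CompactOp 𝓗)}
    (hH : IsSelfAdjoint H) (n : ℕ ⊕ ℕ) : Measurable (energy H n) := by
  have hcont := continuous_toCLM_comp H
  rcases n with n | n
  · exact (lowerSemicontinuous_upperEigenvalue hcont (fun x => (H x).isCompactOperator)
      (fun x => (isSelfAdjoint_apply hH x).isSymmetric) n).measurable
  · exact (lowerSemicontinuous_upperEigenvalue hcont.neg (fun x => (H x).isCompactOperator.neg)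
      (fun x => (isSelfAdjoint_apply hH x).neg.isSymmetric) n).measurable.neg

theorem measurable_bandProduct [MeasurableSpace X] [BorelSpace X] {H : C(X, CompactOp 𝓗)}
    (hH : IsSelfAdjoint H) {l : ℝ} (hfin : FiniteBandContribution H l) :
    Measurable (bandProduct H l hfin) :=
  Finset.measurable_fun_prod _ fun n _ => (measurable_energy hH n).sub_const l

/-- The Fermi surface is the zero set of the band product. -/
theorem bandProduct_eq_zero_iff {H : C(X, CompactOp 𝓗)} (hH : IsSelfAdjoint H) {l : ℝ}
    (hl0 : l ≠ 0) (hfin : FiniteBandContribution H l) (x : X) :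
    bandProduct H l hfin x = 0 ↔ x ∈ fermiSurface H l := by
  have h := mem_spectrum_iff_exists_eigenvalueSeq_eq (H x).isCompactOperator
    (isSelfAdjoint_apply hH x).isSymmetric hl0
  refine Iff.trans ?_ h.symm
  simp only [bandProduct, Finset.prod_eq_zero_iff, sub_eq_zero]
  exact ⟨fun ⟨n, _, hn⟩ => ⟨n, hn⟩, fun ⟨n, hn⟩ => ⟨n, hfin.mem_toFinset.2 ⟨x, hn⟩, hn⟩⟩

theorem finiteDimensional_eigSpace {T : 𝓗 →L[ℂ] 𝓗} (hc : IsCompactOperator T) {z : ℂ}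
    (hz : z ≠ 0) : FiniteDimensional ℂ (eigSpace T z) := by
  rw [eigSpace_eq_eigenspace]
  exact ContinuousLinearMap.finite_dimensional_eigenspace hc z hz

/-- On the Fermi surface, `A ↦ Tr(ρ(x) A)` is an eigenstate of `H(x)` on the bounded operators. -/
theorem exists_isEigenstate_opTrace_densityMatrix (H : C(X, CompactOp 𝓗)) {l : ℝ} (hl0 : l ≠ 0)
    {x : X} (hx : x ∈ fermiSurface H l) : ∃ τ : (𝓗 →L[ℂ] 𝓗) →ₗ[ℂ] ℂ,
      (∀ A, opTrace (densityMatrix H l x * A) = τ A) ∧ (∀ A, ‖τ A‖ ≤ ‖A‖) ∧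
      IsEigenstate τ (H x : 𝓗 →L[ℂ] 𝓗) l := by
  have hlc : (l : ℂ) ≠ 0 := Complex.ofReal_ne_zero.2 hl0
  have := finiteDimensional_eigSpace (H x).isCompactOperator hlc
  have hne := (eigSpace_ne_bot_iff (H x).isCompactOperator hlc).2 hx
  refine ⟨compressedTrace (eigSpace (H x : 𝓗 →L[ℂ] 𝓗) l), fun A => ?_,
    norm_compressedTrace_le _, compressedTrace_isEigenstate _ _ hne⟩
  rw [densityMatrix, if_pos hx]
  exact opTrace_normalized_spectralProj_mul _ _ hne A

theorem densityMatrix_of_notMem {H : C(X, CompactOp 𝓗)} {l : ℝ} {x : X}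
    (hx : x ∉ fermiSurface H l) : densityMatrix H l x = 0 := if_neg hx

/-- `A ↦ Tr(ρ(x) A)` is linear for every `x`, although `opTrace` is not additive on operators that
are not of trace class: off the Fermi surface it vanishes. -/
theorem exists_linearMap_opTrace_densityMatrix (H : C(X, CompactOp 𝓗)) {l : ℝ} (hl0 : l ≠ 0)
    (x : X) : ∃ τ : (𝓗 →L[ℂ] 𝓗) →ₗ[ℂ] ℂ,
      (∀ A, opTrace (densityMatrix H l x * A) = τ A) ∧ ∀ A, ‖τ A‖ ≤ ‖A‖ := by
  by_cases hx : x ∈ fermiSurface H l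
  · obtain ⟨τ, h1, h2, -⟩ := exists_isEigenstate_opTrace_densityMatrix H hl0 hx
    exact ⟨τ, h1, h2⟩
  · exact ⟨0, fun A => by simp [densityMatrix_of_notMem hx, opTrace_zero], fun A => by simp⟩

theorem measurable_opTrace_densityMatrix_mul [TopologicalSpace.SeparableSpace 𝓗]
    [CompactSpace X] [MeasurableSpace X] [BorelSpace X] {H : C(X, CompactOp 𝓗)}
    (hH : IsSelfAdjoint H) {l : ℝ} (hl0 : l ≠ 0) (hfin : FiniteBandContribution H l)
    {A : X → 𝓗 →L[ℂ] 𝓗} (hA : Continuous A) :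
    Measurable fun x => opTrace (densityMatrix H l x * A x) := by
  classical
  have hF : MeasurableSet (fermiSurface H l) := by
    have h : MeasurableSet {x | bandProduct H l hfin x = 0} :=
      measurable_bandProduct hH hfin (measurableSet_singleton 0)
    simp only [bandProduct_eq_zero_iff hH hl0] at h
    exact h
  have hlc : (l : ℂ) ≠ 0 := Complex.ofReal_ne_zero.2 hl0
  have hP {B : X → 𝓗 →L[ℂ] 𝓗} (hB : Continuous B) :=
    measurable_opTrace_spectralProj_mul (continuous_toCLM_comp H) (isSelfAdjoint_apply hH) l
      (fun x => finiteDimensional_eigSpace (H x).isCompactOperator hlc) hB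
  have h1 := hP (B := fun _ => 1) continuous_const
  simp only [mul_one] at h1
  have : (fun x => opTrace (densityMatrix H l x * A x)) = fun x =>
      if x ∈ fermiSurface H l then (opTrace (spectralProj (H x : 𝓗 →L[ℂ] 𝓗) l))⁻¹ *
        opTrace (spectralProj (H x : 𝓗 →L[ℂ] 𝓗) l * A x) else 0 := by
    funext x
    by_cases hx : x ∈ fermiSurface H l
    · rw [if_pos hx, densityMatrix, if_pos hx, smul_mul_assoc, opTrace_smul]
    · rw [if_neg hx, densityMatrix_of_notMem hx, zero_mul, opTrace_zero]
  rw [this]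
  exact Measurable.ite hF (h1.inv.mul (hP hA)) measurable_const

end Families

/-! ### The Fermi eigenstate -/

section Eigenstate

variable {𝓗 : Type*} [NormedAddCommGroup 𝓗] [InnerProductSpace ℂ 𝓗] [CompleteSpace 𝓗]
  [TopologicalSpace.SeparableSpace 𝓗] {X : Type*} [TopologicalSpace X] [CompactSpace X]
  [MeasurableSpace X] [BorelSpace X]

theorem integrable_opTrace_densityMatrix_mul {H : C(X, CompactOp 𝓗)} (hH : IsSelfAdjoint H)
    {l : ℝ} (hl0 : l ≠ 0) (hfin : FiniteBandContribution H l) (m : Measure X) [IsFiniteMeasure m]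
    {A : X → 𝓗 →L[ℂ] 𝓗} (hA : Continuous A) :
    Integrable (fun x => opTrace (densityMatrix H l x * A x)) m := by
  obtain ⟨R, hR⟩ := isCompact_univ.exists_bound_of_continuousOn hA.continuousOn
  refine Integrable.of_bound
    (measurable_opTrace_densityMatrix_mul hH hl0 hfin hA).aestronglyMeasurable R
    (ae_of_all _ fun x => ?_)
  obtain ⟨τ, h1, h2⟩ := exists_linearMap_opTrace_densityMatrix H hl0 x
  rw [h1]
  exact (h2 _).trans (hR x trivial)

/-- The functional `A ↦ ∫ Tr(ρ(x) A(x)) dm(x)` on `C(X, 𝔎)`. -/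
def fermiFunctional {H : C(X, CompactOp 𝓗)} (hH : IsSelfAdjoint H) {l : ℝ} (hl0 : l ≠ 0)
    (hfin : FiniteBandContribution H l) (m : Measure X) [IsProbabilityMeasure m] :
    C(X, CompactOp 𝓗) →L[ℂ] ℂ :=
  LinearMap.mkContinuous
    { toFun := fun A => ∫ x, opTrace (densityMatrix H l x * (A x : 𝓗 →L[ℂ] 𝓗)) ∂m
      map_add' := fun A B => by
        rw [← integral_add
          (integrable_opTrace_densityMatrix_mul hH hl0 hfin m (continuous_toCLM_comp A))
          (integrable_opTrace_densityMatrix_mul hH hl0 hfin m (continuous_toCLM_comp B))]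
        refine integral_congr_ae (ae_of_all _ fun x => ?_)
        obtain ⟨τ, h1, -⟩ := exists_linearMap_opTrace_densityMatrix H hl0 x
        simp only [h1]
        exact map_add τ _ _
      map_smul' := fun c A => by
        rw [RingHom.id_apply, smul_eq_mul, ← integral_const_mul]
        refine integral_congr_ae (ae_of_all _ fun x => ?_)
        obtain ⟨τ, h1, -⟩ := exists_linearMap_opTrace_densityMatrix H hl0 x
        simp only [h1]
        exact map_smul τ c _ } 1 fun A => by
    refine (norm_integral_le_of_norm_le_const (C := ‖A‖) (ae_of_all _ fun x => ?_)).trans ?_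
    · obtain ⟨τ, h1, h2⟩ := exists_linearMap_opTrace_densityMatrix H hl0 x
      rw [h1]
      exact (h2 _).trans (A.norm_coe_le_norm x)
    · simp

theorem fermiFunctional_apply {H : C(X, CompactOp 𝓗)} (hH : IsSelfAdjoint H) {l : ℝ} (hl0 : l ≠ 0)
    (hfin : FiniteBandContribution H l) (m : Measure X) [IsProbabilityMeasure m]
    (A : C(X, CompactOp 𝓗)) : fermiFunctional hH hl0 hfin m A =
      ∫ x, opTrace (densityMatrix H l x * (A x : 𝓗 →L[ℂ] 𝓗)) ∂m := rfl

/-- For a measure carried by the Fermi surface, the integral of the local states computes the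
extension of the functional with value `1` at the unit. -/
theorem integral_opTrace_densityMatrix_evalHom {H : C(X, CompactOp 𝓗)} (hH : IsSelfAdjoint H)
    {l : ℝ} (hl0 : l ≠ 0) (hfin : FiniteBandContribution H l) (m : Measure X)
    [IsProbabilityMeasure m] (hm : ∀ᵐ x ∂m, x ∈ fermiSurface H l)
    (z : Unitization ℂ C(X, CompactOp 𝓗)) :
    ∫ x, opTrace (densityMatrix H l x * evalHom x z) ∂m =
      fermiFunctional hH hl0 hfin m z.snd + z.fst := by
  have h : ∀ᵐ x ∂m, opTrace (densityMatrix H l x * evalHom x z) =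
      opTrace (densityMatrix H l x * (z.snd x : 𝓗 →L[ℂ] 𝓗)) + z.fst := by
    filter_upwards [hm] with x hx
    obtain ⟨τ, h1, -, h3⟩ := exists_isEigenstate_opTrace_densityMatrix H hl0 hx
    rw [h1, h1, evalHom_apply, map_add, map_smul, h3.isState.map_one, smul_eq_mul, mul_one,
      add_comm]
  rw [integral_congr_ae h, integral_add
    (integrable_opTrace_densityMatrix_mul hH hl0 hfin m (continuous_toCLM_comp z.snd))
    (integrable_const _), fermiFunctional_apply]
  simp

/-- The powers `Gⁿ` of `G = 1 - (H - l)² / C` have the value `1` in the eigenstates, norm at most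
`1`, and scalar part `(1 - l² / C)ⁿ → 0`; their compact parts show that the norm is `1`. -/
theorem norm_fermiFunctional {H : C(X, CompactOp 𝓗)} (hH : IsSelfAdjoint H)
    {l : ℝ} (hl0 : l ≠ 0) (hfin : FiniteBandContribution H l) (m : Measure X)
    [IsProbabilityMeasure m] (hm : ∀ᵐ x ∂m, x ∈ fermiSurface H l) :
    ‖fermiFunctional hH hl0 hfin m‖ = 1 := by
  refine le_antisymm (LinearMap.mkContinuous_norm_le _ zero_le_one _) ?_
  set ω := fermiFunctional hH hl0 hfin m
  set C : ℝ := (‖H‖ + |l|) ^ 2 with hC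
  have hl2 : 0 < l ^ 2 := by positivity
  have hlC : l ^ 2 ≤ C := by
    rw [← sq_abs l, hC]
    gcongr
    linarith [norm_nonneg H]
  have hC0 : 0 < C := hl2.trans_le hlC
  set q : ℝ := 1 - C⁻¹ * l ^ 2 with hq
  have hq0 : 0 ≤ q := by
    rw [hq, sub_nonneg, inv_mul_le_iff₀ hC0, mul_one]
    exact hlC
  have hq1 : q < 1 := by
    have : 0 < C⁻¹ * l ^ 2 := by positivity
    linarith
  set G : Unitization ℂ C(X, CompactOp 𝓗) :=
    1 - ((C⁻¹ : ℝ) : ℂ) • (((H : Unitization ℂ C(X, CompactOp 𝓗)) - (l : ℂ) • 1) *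
      ((H : Unitization ℂ C(X, CompactOp 𝓗)) - (l : ℂ) • 1)) with hG
  have hGx (x : X) : evalHom x G = peakOperator (H x : 𝓗 →L[ℂ] 𝓗) l C := by
    simp only [hG, map_sub, map_smul, map_mul, map_one, evalHom_inr, peakOperator]
  have hnorm (x : X) : ‖evalHom x G‖ ≤ 1 := by
    rw [hGx]
    refine norm_peakOperator_le (isSelfAdjoint_apply hH x) hC0 ?_
    rw [hC]
    gcongr
    refine (norm_sub_le _ _).trans (add_le_add (H.norm_coe_le_norm x) ?_)
    rw [norm_smul, Complex.norm_real, Real.norm_eq_abs]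
    exact mul_le_of_le_one_right (abs_nonneg l) ContinuousLinearMap.norm_id_le
  have hfst : G.fst = (q : ℂ) := by
    have e : ((H : Unitization ℂ C(X, CompactOp 𝓗)) - (l : ℂ) • 1).fst = -(l : ℂ) := by
      change (0 : ℂ) - (l : ℂ) * 1 = _
      ring
    change (1 : ℂ) - ((C⁻¹ : ℝ) : ℂ) * ((_ : Unitization ℂ C(X, CompactOp 𝓗)) * _).fst = _
    rw [Unitization.fst_mul, e, hq]
    push_cast
    ring
  have hpow (n : ℕ) : (G ^ n).fst = ((q ^ n : ℝ) : ℂ) := by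
    rw [Complex.ofReal_pow, ← hfst]
    exact map_pow (Unitization.fstHom ℂ C(X, CompactOp 𝓗)) G n
  have hAn (n : ℕ) : ‖(G ^ n).snd‖ ≤ 1 + q ^ n := by
    refine (ContinuousMap.norm_le _ (by positivity)).2 fun x => ?_
    have e := evalHom_apply x (G ^ n)
    rw [hpow] at e
    rw [← CompactOp.norm_toCLM, ← sub_eq_iff_eq_add'.2 e]
    refine (norm_sub_le _ _).trans (add_le_add ?_ ?_)
    · rw [map_pow]
      rcases Nat.eq_zero_or_pos n with rfl | hn
      · rw [pow_zero]
        exact ContinuousLinearMap.norm_id_le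
      · exact (norm_pow_le' _ hn).trans (pow_le_one₀ (norm_nonneg _) (hnorm x))
    · rw [norm_smul, Complex.norm_real, Real.norm_of_nonneg (by positivity)]
      exact mul_le_of_le_one_right (by positivity) ContinuousLinearMap.norm_id_le
  have hω (n : ℕ) : ω (G ^ n).snd = ((1 - q ^ n : ℝ) : ℂ) := by
    have h1 := integral_opTrace_densityMatrix_evalHom hH hl0 hfin m hm (G ^ n)
    have h2 : ∀ᵐ x ∂m, opTrace (densityMatrix H l x * evalHom x (G ^ n)) = 1 := by
      filter_upwards [hm] with x hx
      obtain ⟨τ, e1, -, e3⟩ := exists_isEigenstate_opTrace_densityMatrix H hl0 hx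
      rw [e1, map_pow, hGx]
      exact e3.map_peakOperator_pow n
    rw [integral_congr_ae h2, hpow] at h1
    simp only [integral_const, probReal_univ, one_smul] at h1
    rw [Complex.ofReal_sub, Complex.ofReal_one]
    exact eq_sub_of_add_eq h1.symm
  have hle (n : ℕ) : 1 - q ^ n ≤ ‖ω‖ * (1 + q ^ n) := by
    have h1 := ω.le_opNorm (G ^ n).snd
    rw [hω, Complex.norm_real, Real.norm_eq_abs] at h1
    exact (le_abs_self _).trans (h1.trans (mul_le_mul_of_nonneg_left (hAn n) (norm_nonneg _)))
  have hlim := tendsto_pow_atTop_nhds_zero_of_lt_one hq0 hq1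
  have := le_of_tendsto_of_tendsto' (hlim.const_sub 1) ((hlim.const_add 1).const_mul ‖ω‖) hle
  simpa using this

theorem isEigenstate_canonicalExtension_fermiFunctional {H : C(X, CompactOp 𝓗)}
    (hH : IsSelfAdjoint H) {l : ℝ} (hl0 : l ≠ 0) (hfin : FiniteBandContribution H l)
    (m : Measure X) [IsProbabilityMeasure m] (hm : ∀ᵐ x ∂m, x ∈ fermiSurface H l) :
    IsEigenstate (canonicalExtension (fermiFunctional hH hl0 hfin m))
      (H : Unitization ℂ C(X, CompactOp 𝓗)) (l : ℂ) := by
  have hval (z : Unitization ℂ C(X, CompactOp 𝓗)) :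
      canonicalExtension (fermiFunctional hH hl0 hfin m) z =
        ∫ x, opTrace (densityMatrix H l x * evalHom x z) ∂m := by
    rw [integral_opTrace_densityMatrix_evalHom hH hl0 hfin m hm z]
    change _ + _ * ((‖fermiFunctional hH hl0 hfin m‖ : ℝ) : ℂ) = _
    rw [norm_fermiFunctional hH hl0 hfin m hm, Complex.ofReal_one, mul_one]
  refine ⟨⟨fun b => ?_, ?_⟩, fun b => ?_⟩
  · rw [hval]
    refine integral_nonneg_of_ae ?_
    filter_upwards [hm] with x hx
    obtain ⟨τ, h1, -, h3⟩ := exists_isEigenstate_opTrace_densityMatrix H hl0 hx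
    rw [h1, map_mul, map_star]
    exact h3.isState.nonneg _
  · rw [hval, integral_opTrace_densityMatrix_evalHom hH hl0 hfin m hm]
    simp
  · rw [hval, hval, ← integral_const_mul]
    refine integral_congr_ae ?_
    filter_upwards [hm] with x hx
    obtain ⟨τ, h1, -, h3⟩ := exists_isEigenstate_opTrace_densityMatrix H hl0 hx
    rw [h1, h1, map_mul, evalHom_inr, h3.map_mul]

end Eigenstate

end FermiEigenstate

end

theorem mainTheorem1
    {X : Type*} [MetricSpace X] [CompactSpace X] [MeasurableSpace X] [BorelSpace X]
    (μ : MeasureTheory.Measure X) [MeasureTheory.IsProbabilityMeasure μ]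
    {𝓗 : Type*} [NormedAddCommGroup 𝓗] [InnerProductSpace ℂ 𝓗] [CompleteSpace 𝓗]
    [TopologicalSpace.SeparableSpace 𝓗]
    (H : C(X, FermiEigenstate.CompactOp 𝓗)) (hH : IsSelfAdjoint H)
    (l : ℝ)
    (hl : (l : ℂ) ∈ spectrum ℂ (H : Unitization ℂ C(X, FermiEigenstate.CompactOp 𝓗)))
    (hl0 : l ≠ 0)
    (hfin : FermiEigenstate.FiniteBandContribution H l)
    (hgap : FermiEigenstate.LocalGap H l) :
    (∃ m : MeasureTheory.Measure X, FermiEigenstate.IsFermiMeasure μ H l hfin m) ∧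
    ∀ m : MeasureTheory.Measure X, FermiEigenstate.IsFermiMeasure μ H l hfin m →
      ∃ ω : C(X, FermiEigenstate.CompactOp 𝓗) →L[ℂ] ℂ,
        (∀ A : C(X, FermiEigenstate.CompactOp 𝓗),
          MeasureTheory.Integrable (fun x => FermiEigenstate.opTrace
            (FermiEigenstate.densityMatrix H l x * (A x : 𝓗 →L[ℂ] 𝓗))) m ∧
          ω A = ∫ x, FermiEigenstate.opTrace
            (FermiEigenstate.densityMatrix H l x * (A x : 𝓗 →L[ℂ] 𝓗)) ∂m) ∧
        FermiEigenstate.IsEigenstate (FermiEigenstate.canonicalExtension ω)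
          (H : Unitization ℂ C(X, FermiEigenstate.CompactOp 𝓗)) (l : ℂ) := by
  have hF := FermiEigenstate.fermiSurface_nonempty hl0 hl
  have hset (t : ℝ) : {x | FermiEigenstate.bandProduct H l hfin x = t - l} =
      {x | FermiEigenstate.bandProduct H l hfin x + l = t} :=
    Set.ext fun x => eq_sub_iff_add_eq
  refine ⟨?_, ?_⟩
  · have : Nonempty X := hF.to_type
    obtain ⟨κ, h1, h2⟩ := FermiEigenstate.exists_isDisintegration_carried μ
      ((FermiEigenstate.measurable_bandProduct hH hfin).add_const l)
    exact ⟨κ l, κ, h1, fun t ht => by rw [hset] at ht ⊢; exact h2 t ht, rfl⟩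
  · rintro m ⟨κ, h1, h2, rfl⟩
    have := h1.isProbabilityMeasure l
    have hzero : {x | FermiEigenstate.bandProduct H l hfin x = l - l} =
        FermiEigenstate.fermiSurface H l := by
      rw [sub_self]
      exact Set.ext fun x => FermiEigenstate.bandProduct_eq_zero_iff hH hl0 hfin x
    have hm : ∀ᵐ x ∂(κ l), x ∈ FermiEigenstate.fermiSurface H l := by
      have := h2 l (by rw [hzero]; exact hF)
      rwa [hzero] at this
    exact ⟨FermiEigenstate.fermiFunctional hH hl0 hfin (κ l), fun A =>
      ⟨FermiEigenstate.integrable_opTrace_densityMatrix_mul hH hl0 hfin (κ l)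
        (FermiEigenstate.continuous_toCLM_comp A), rfl⟩,
      FermiEigenstate.isEigenstate_canonicalExtension_fermiFunctional hH hl0 hfin (κ l) hm⟩
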